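/- Let $d\ge 1$ be an integer and $1<p<\infty$. For a real-valued $f\in L^1_{\rm loc}(\mathbb{R}^d)$ and $(a,r)\in\mathbb{R}^{d+1}_+:=\mathbb{R}^d\times(0,\infty)$, let $B_r(a)=\{x\in\mathbb{R}^d:|x-a|<r\}$ and $$m_f(a,r):=\frac1{|B_r(a)|}\int_{B_r(a)}\left|f(x)-\frac1{|B_r(a)|}\int_{B_r(a)}f(y)\,dy\right|dx ,$$ and let $\nu_p$ be the measure on $\mathbb{R}^{d+1}_+$ with $d\nu_p(a,r)=\frac{da\,dr}{r^{p+1}}$. Let $\dot W^{1,p}(\mathbb{R}^d)$ be the space of all $f\in L^1_{\rm loc}(\mathbb{R}^d)$ whose distributional gradient satisfies $\nabla f\in L^p(\mathbb{R}^d)$, and let $L^p_{\rm weak}(\mathbb{R}^{d+1}_+,\nu_p)$ be the space of all measurable $F$ on $\mathbb{R}^{d+1}_+$ with $\sup_{\kappa>0}\kappa^p\nu_p(\{|F|>\kappa\})<\infty$. (i) For every real-valued $f\in L^1_{\rm loc}(\mathbb{R}^d)$ one has $f\in\dot W^{1,p}(\mathbb{R}^d)$ if and only if $m_f\in L^p_{\rm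 weak}(\mathbb{R}^{d+1}_+,\nu_p)$. (ii) There are constants $C_1,C_2\in(0,\infty)$, depending only on $d$ and $p$, such that for every real-valued $f\in L^1_{\rm loc}(\mathbb{R}^d)$ whose distributional gradient is a locally integrable function (in particular for every real-valued $f\in\dot W^{1,p}(\mathbb{R}^d)$), $$C_1\,\|\nabla f\|_{L^p(\mathbb{R}^d)}^p\le\sup_{\kappa>0}\kappa^p\,\nu_p(\{m_f>\kappa\})\le C_2\,\|\nabla f\|_{L^p(\mathbb{R}^d)}^p ,$$ where $\|\nabla f\|_{L^p(\mathbb{R}^d)}:=\infty$ if $\nabla f\notin L^p(\mathbb{R}^d)$. (iii) For every real-valued $f\in\dot W^{1,p}(\mathbb{R}^d)$, $$\lim_{\kappa\to0^+}\kappa^p\,\nu_p(\{m_f>\kappa\})=c_{d,p}\,\|\nabla f\|_{L^p(\mathbb{R}^d)}^p,\qquad c_{d,p}=p^{-1}\left(\frac1{\sqrt\pi}\,\frac{\Gamma(\frac{d+2}2)}{\Gamma(\frac{d+3}2)}\right)^p .$$ -/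

import Mathlib

open MeasureTheory Filter Topology
open scoped ContDiff

/-- The space `ℝ^d` with its Euclidean norm and Lebesgue measure. -/
abbrev Rd (d : ℕ) : Type := EuclideanSpace ℝ (Fin d)

/-- The locally integrable field `g` is the distributional gradient of `f`:
`∫ f ∂ᵢφ = - ∫ gᵢ φ` for every smooth, compactly supported `φ` and every coordinate `i`. -/
def HasWeakGradient {d : ℕ} (f : Rd d → ℝ) (g : Rd d → Rd d) : Prop :=
  LocallyIntegrable g volume ∧
    ∀ φ : Rd d → ℝ, ContDiff ℝ ∞ φ → HasCompactSupport φ → ∀ i : Fin d,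
      ∫ x, f x * fderiv ℝ φ x (EuclideanSpace.single i 1) = -∫ x, g x i * φ x

/-- Membership in the homogeneous Sobolev space of order one: `f` is locally integrable and its
distributional gradient is in `L^p`. -/
def MemHomSobolev {d : ℕ} (p : ℝ) (f : Rd d → ℝ) : Prop :=
  LocallyIntegrable f volume ∧
    ∃ g : Rd d → Rd d, HasWeakGradient f g ∧ MemLp g (ENNReal.ofReal p) volume

/-- The mean oscillation of `f` on the open ball with center `q.1` and radius `q.2`. -/
noncomputable def meanOsc {d : ℕ} (f : Rd d → ℝ) (q : Rd d × ℝ) : ℝ :=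
  ⨍ x in Metric.ball q.1 q.2, |f x - ⨍ y in Metric.ball q.1 q.2, f y|

/-- The measure `da dr / r^(p+1)` on the half-space `r > 0`, as a measure on `ℝ^d × ℝ` that is
carried by this half-space. -/
noncomputable def halfSpaceMeasure (d : ℕ) (p : ℝ) : Measure (Rd d × ℝ) :=
  ((volume : Measure (Rd d × ℝ)).restrict {q | 0 < q.2}).withDensity
    fun q => ENNReal.ofReal (1 / q.2 ^ (p + 1))

/-- Membership in weak `L^p` with respect to `μ`. -/
def MemWeakLp {α : Type*} [MeasurableSpace α] (p : ℝ) (F : α → ℝ) (μ : Measure α) : Prop :=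
  AEStronglyMeasurable F μ ∧
    (⨆ (κ : ℝ) (_ : 0 < κ), ENNReal.ofReal (κ ^ p) * μ {x | κ < |F x|}) < ⊤

/-- The constant in the limit relation. -/
noncomputable def limitConst (d : ℕ) (p : ℝ) : ℝ :=
  p⁻¹ * (1 / √Real.pi * (Real.Gamma (((d : ℝ) + 2) / 2) / Real.Gamma (((d : ℝ) + 3) / 2))) ^ p

/-! Near a Lebesgue point `a` of `g = ∇f`, the function `f` differs from the linear function `⟨g a,
·⟩` by something whose oscillation on `B_r(a)` is `o(r)`, by the Poincaré inequality. Hence `m_f(a,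
r) ≈ c r |g a|`, where `c` is the mean of `|x₁|` over the unit ball
(`HasWeakGradient.tendsto_meanOsc_div`). Substituting `r = κρ` absorbs the factor `κ^p`: the
quantity of interest becomes the `ν_p`-measure of `{m_f(a, κρ) > κ}`, and these sets converge almost
everywhere to `{ρ c |g a| > 1}`, whose measure is `p⁻¹ c^p ∫ |g|^p`. Fatou's lemma gives the lower
bound, without assuming `g ∈ L^p`.

For the upper bound no maximal function is used. By Poincaré, the indicator of the rescaled set is
at most the mean over `B_{κρ}(a)` of `(2^(d+2) ρ |g| - 1)₊`. Averaging over balls of fixed radius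
preserves the integral in `a`, so the `ν_p`-integral of this majorant does not depend on `κ`, and
for `p > 1` it is at most a constant times `∫ |g|^p`. The same majorants converge pointwise with
constant integral, so dominated convergence with varying majorants gives the limit.

Conversely, let the weak quasinorm of `m_f` be finite. Difference quotients of the means of `f` over
`ε`-balls are controlled by `m_f(x, r) / ε` for all `r ∈ [2ε, 3ε]`, hence are bounded in weak `L^p`
uniformly in `ε` (`weak_bound_meanQuotient`). For `p > 1` this gives uniform integrability on a
finite measure space, hence a weak limit, which is the distributional derivative. The lower bound
then puts the gradient in `L^p`. -/

/-! ### The mean of `|x₁|` over the unit ball and the oscillation of linear functions. -/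

theorem integral_abs_mul_exp_neg_sq : ∫ t : ℝ, |t| * Real.exp (-t ^ 2) = 1 := by
  have h := integral_comp_abs (f := fun t : ℝ => t * Real.exp (-t ^ 2))
  simp only [sq_abs] at h
  rw [h]
  have h2 := integral_rpow_mul_exp_neg_rpow (p := 2) (q := 1) (by norm_num) (by norm_num)
  norm_num at h2
  rw [h2]
  norm_num

theorem integral_abs_coord_mul_exp_neg_norm_sq {d : ℕ} (i : Fin d) :
    ∫ x : Rd d, |x i| * Real.exp (-‖x‖ ^ 2) = √Real.pi ^ (d - 1) := by
  rw [← (PiLp.volume_preserving_toLp (Fin d)).integral_comp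
    (MeasurableEquiv.toLp 2 _).measurableEmbedding]
  have h := integral_fintype_prod_volume_eq_prod
    (fun (j : Fin d) (t : ℝ) => (if j = i then |t| else 1) * Real.exp (-t ^ 2))
  have h1 : ∀ x : Fin d → ℝ, |(WithLp.toLp 2 x : Rd d) i| * Real.exp (-‖(WithLp.toLp 2 x : Rd d)‖ ^ 2)
      = ∏ j, (if j = i then |x j| else 1) * Real.exp (-x j ^ 2) := by
    intro x
    rw [Finset.prod_mul_distrib, Finset.prod_ite_eq' Finset.univ i (fun j => |x j|),
      ← Real.exp_sum, EuclideanSpace.norm_sq_eq]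
    simp
  simp_rw [h1]
  rw [h, ← Finset.mul_prod_erase Finset.univ _ (Finset.mem_univ i)]
  have h3 : ∀ j ∈ Finset.univ.erase i,
      ∫ t : ℝ, (if j = i then |t| else 1) * Real.exp (-t ^ 2) = √Real.pi := by
    intro j hj
    have := integral_gaussian 1
    simpa [(Finset.mem_erase.1 hj).1] using this
  rw [Finset.prod_congr rfl h3]
  simp [integral_abs_mul_exp_neg_sq]

theorem setIntegral_ball_abs_coord {d : ℕ} (i : Fin d) {t : ℝ} (ht : 0 < t) :
    ∫ x in Metric.ball (0 : Rd d) t, |x i| =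
      t ^ (d + 1) * ∫ x in Metric.ball (0 : Rd d) 1, |x i| := by
  have h := Measure.setIntegral_comp_smul_of_pos (volume : Measure (Rd d))
    (fun x : Rd d => |x i|) (Metric.ball 0 1) ht
  rw [_root_.smul_ball ht.ne'] at h
  simp only [PiLp.smul_apply, smul_eq_mul, abs_mul, abs_of_pos ht, smul_zero, Real.norm_eq_abs,
    mul_one, finrank_euclideanSpace, Fintype.card_fin] at h
  rw [integral_const_mul] at h
  rw [pow_succ, mul_assoc, h]
  field_simp

theorem lintegral_ball_abs_coord {d : ℕ} (i : Fin d) {t : ℝ} :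
    ∫⁻ x in Metric.ball (0 : Rd d) t, ENNReal.ofReal |x i| =
      ENNReal.ofReal (∫ x in Metric.ball (0 : Rd d) t, |x i|) := by
  rw [ofReal_integral_eq_lintegral_ofReal _ (ae_of_all _ fun x => abs_nonneg _)]
  have : Continuous fun x : Rd d => |x i| := by fun_prop
  exact this.locallyIntegrable.integrableOn_isCompact (isCompact_closedBall 0 t)
    |>.mono_set Metric.ball_subset_closedBall

theorem lintegral_Ioi_two_mul_exp_neg_sq {s : ℝ} (hs : 0 ≤ s) :
    ∫⁻ t in Set.Ioi s, ENNReal.ofReal (2 * t * Real.exp (-t ^ 2)) =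
      ENNReal.ofReal (Real.exp (-s ^ 2)) := by
  have hd : ∀ t ∈ Set.Ici s, HasDerivAt (fun t : ℝ => -Real.exp (-t ^ 2))
      (2 * t * Real.exp (-t ^ 2)) t := by
    intro t _
    have := ((hasDerivAt_pow 2 t).neg.exp).neg
    convert! this using 1
    simp; ring
  have hl : Tendsto (fun t : ℝ => -Real.exp (-t ^ 2)) atTop (𝓝 0) := by
    rw [← neg_zero]
    exact (Real.tendsto_exp_neg_atTop_nhds_zero.comp (tendsto_pow_atTop two_ne_zero)).neg
  have hn : ∀ t ∈ Set.Ioi s, 0 ≤ 2 * t * Real.exp (-t ^ 2) := fun t ht => by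
    have : 0 < t := lt_of_le_of_lt hs ht
    positivity
  have hi := integrableOn_Ioi_deriv_of_nonneg' hd hn hl
  rw [← ofReal_integral_eq_lintegral_ofReal hi
    ((ae_restrict_iff' measurableSet_Ioi).2 (ae_of_all _ hn)),
    integral_Ioi_of_hasDerivAt_of_tendsto' hd hi hl]
  simp

/-- The Gaussian integral of `|x i|`, known from Fubini, is evaluated a second time by writing `exp
(-‖x‖²)` as `∫ 2t exp (-t²) dt` over `t > ‖x‖`. By homogeneity the ball of radius `t` contributes
`t^(d+1) J`, so the result is `J Γ((d+3)/2)`. -/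
theorem setIntegral_unitBall_abs_coord {d : ℕ} (i : Fin d) :
    ∫ x in Metric.ball (0 : Rd d) 1, |x i| =
      √Real.pi ^ (d - 1) / Real.Gamma (((d : ℝ) + 3) / 2) := by
  set J := ∫ x in Metric.ball (0 : Rd d) 1, |x i| with hJ
  have hJ0 : 0 ≤ J := integral_nonneg fun x => abs_nonneg _
  have hG : 0 < Real.Gamma (((d : ℝ) + 3) / 2) := Real.Gamma_pos_of_pos (by positivity)
  have h1 : ∫⁻ x : Rd d, ENNReal.ofReal (|x i| * Real.exp (-‖x‖ ^ 2)) =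
      ENNReal.ofReal (√Real.pi ^ (d - 1)) := by
    rw [← integral_abs_coord_mul_exp_neg_norm_sq i, ofReal_integral_eq_lintegral_ofReal]
    -- A non-integrable function has integral `0`, so the positive value already computed forces
    -- integrability.
    · by_contra hc
      have := integral_abs_coord_mul_exp_neg_norm_sq i
      rw [integral_undef hc] at this
      have : 0 < √Real.pi ^ (d - 1) := by positivity
      linarith
    · exact ae_of_all _ fun x => by positivity
  have h2 : ∫⁻ x : Rd d, ENNReal.ofReal (|x i| * Real.exp (-‖x‖ ^ 2)) =
      ∫⁻ t in Set.Ioi (0 : ℝ), ∫⁻ x : Rd d, (Metric.ball (0 : Rd d) t).indicator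
        (fun x => ENNReal.ofReal |x i| * ENNReal.ofReal (2 * t * Real.exp (-t ^ 2))) x := by
    rw [lintegral_lintegral_swap]
    · refine lintegral_congr fun x => ?_
      rw [ENNReal.ofReal_mul (abs_nonneg _), ← lintegral_Ioi_two_mul_exp_neg_sq (norm_nonneg x),
        ← lintegral_const_mul _ (by fun_prop), ← lintegral_indicator measurableSet_Ioi,
        ← lintegral_indicator measurableSet_Ioi]
      refine lintegral_congr fun t => ?_
      by_cases hxt : ‖x‖ < t
      · have : 0 < t := (norm_nonneg x).trans_lt hxt
        simp [Set.indicator, hxt, this]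
      · simp [Set.indicator, hxt]
    · refine Measurable.aemeasurable ?_
      have hs : MeasurableSet {q : ℝ × Rd d | ‖q.2‖ < q.1} :=
        measurableSet_lt (by fun_prop) (by fun_prop)
      have := Measurable.indicator (f := fun q : ℝ × Rd d => ENNReal.ofReal |q.2 i| *
        ENNReal.ofReal (2 * q.1 * Real.exp (-q.1 ^ 2))) (by fun_prop) hs
      convert! this using 1
      ext q
      simp [Function.uncurry, Set.indicator]
  have h3 : ∀ t ∈ Set.Ioi (0 : ℝ), ∫⁻ x : Rd d, (Metric.ball (0 : Rd d) t).indicator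
        (fun x => ENNReal.ofReal |x i| * ENNReal.ofReal (2 * t * Real.exp (-t ^ 2))) x =
      ENNReal.ofReal (2 * J * (t ^ ((d : ℝ) + 2) * Real.exp (-t ^ (2 : ℝ)))) := by
    intro t ht
    have ht : 0 < t := ht
    rw [lintegral_indicator Metric.isOpen_ball.measurableSet, lintegral_mul_const _ (by fun_prop),
      lintegral_ball_abs_coord, setIntegral_ball_abs_coord i ht,
      ← ENNReal.ofReal_mul (by positivity)]
    congr 1
    rw [show ((d : ℝ) + 2) = ((d + 2 : ℕ) : ℝ) by push_cast; ring, Real.rpow_natCast,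
      Real.rpow_two]
    ring
  rw [h1, setLIntegral_congr_fun measurableSet_Ioi h3] at h2
  have h4 := integral_rpow_mul_exp_neg_rpow (p := 2) (q := (d : ℝ) + 2) (by norm_num)
    (by have : (0:ℝ) ≤ d := Nat.cast_nonneg d; linarith)
  have h5 : IntegrableOn (fun t : ℝ => t ^ ((d : ℝ) + 2) * Real.exp (-t ^ (2 : ℝ)))
      (Set.Ioi 0) := by
    by_contra hc
    rw [integral_undef hc] at h4
    have : 0 < Real.Gamma (((d : ℝ) + 2 + 1) / 2) := Real.Gamma_pos_of_pos (by positivity)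
    linarith
  rw [← ofReal_integral_eq_lintegral_ofReal (h5.const_mul _), integral_const_mul, h4,
    ENNReal.ofReal_eq_ofReal_iff (by positivity)] at h2
  · rw [h2]
    rw [show (d : ℝ) + 2 + 1 = d + 3 by ring]
    field_simp
  · have : (d : ℝ) + 2 + 1 = d + 3 := by ring
    rw [this]; positivity
  · refine (ae_restrict_iff' measurableSet_Ioi).2 (ae_of_all _ fun t ht => ?_)
    have : 0 < t := ht
    simp only [Pi.zero_apply]
    positivity

theorem setIntegral_ball_comp_add {d : ℕ} (F : Rd d → ℝ) (a b : Rd d) (r : ℝ) :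
    ∫ x in Metric.ball b r, F (a + x) = ∫ x in Metric.ball (a + b) r, F x := by
  have := (measurePreserving_add_left (volume : Measure (Rd d)) a).setIntegral_preimage_emb
    (measurableEmbedding_addLeft a) F (Metric.ball (a + b) r)
  rw [← this]
  congr 2
  ext x
  simp

theorem setAverage_ball_eq_unitBall {d : ℕ} (F : Rd d → ℝ) (a : Rd d) {r : ℝ} (hr : 0 < r) :
    ⨍ x in Metric.ball a r, F x = ⨍ z in Metric.ball (0 : Rd d) 1, F (a + r • z) := by
  have h := Measure.setIntegral_comp_smul_of_pos (volume : Measure (Rd d))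
    (fun x : Rd d => F (a + x)) (Metric.ball 0 1) hr
  rw [_root_.smul_ball hr.ne', smul_zero, Real.norm_eq_abs, abs_of_pos hr, mul_one,
    setIntegral_ball_comp_add, add_zero] at h
  have hv : volume.real (Metric.ball a r) =
      r ^ Module.finrank ℝ (Rd d) * volume.real (Metric.ball (0 : Rd d) 1) := by
    rw [measureReal_def, Measure.addHaar_ball_of_pos _ _ hr, ENNReal.toReal_mul,
      ENNReal.toReal_ofReal (by positivity), measureReal_def]
  rw [setAverage_eq, setAverage_eq, h, hv]
  simp only [smul_eq_mul]
  rw [mul_inv]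
  ring

/-- The mean of `|x₁|` over the unit ball of `ℝ^d`. -/
noncomputable def firstAbsMoment (d : ℕ) : ℝ :=
  1 / √Real.pi * (Real.Gamma (((d : ℝ) + 2) / 2) / Real.Gamma (((d : ℝ) + 3) / 2))

theorem firstAbsMoment_pos (d : ℕ) : 0 < firstAbsMoment d := by
  have h1 : 0 < Real.Gamma (((d : ℝ) + 3) / 2) := Real.Gamma_pos_of_pos (by positivity)
  have h2 : 0 < Real.Gamma (((d : ℝ) + 2) / 2) := Real.Gamma_pos_of_pos (by positivity)
  unfold firstAbsMoment
  positivity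

theorem setAverage_unitBall_abs_coord {d : ℕ} (i : Fin d) :
    ⨍ x in Metric.ball (0 : Rd d) 1, |x i| = firstAbsMoment d := by
  have : Nonempty (Fin d) := ⟨i⟩
  have h2 : 0 < Real.Gamma (((d : ℝ) + 2) / 2) := Real.Gamma_pos_of_pos (by positivity)
  have hv : volume.real (Metric.ball (0 : Rd d) 1) =
      √Real.pi ^ d / Real.Gamma (((d : ℝ) + 2) / 2) := by
    rw [measureReal_def, EuclideanSpace.volume_ball]
    simp only [Fintype.card_fin]
    rw [show (d : ℝ) / 2 + 1 = (d + 2) / 2 by ring]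
    simp only [ENNReal.ofReal_one, one_pow, one_mul]
    rw [ENNReal.toReal_ofReal (by positivity)]
  have hd : √Real.pi ^ d = √Real.pi ^ (d - 1) * √Real.pi := by
    rw [← pow_succ, Nat.sub_add_cancel i.pos]
  have h0 : 0 < √Real.pi := Real.sqrt_pos.2 Real.pi_pos
  rw [setAverage_eq, setIntegral_unitBall_abs_coord i, hv, hd, firstAbsMoment, smul_eq_mul]
  field_simp

/-- Rotation invariance: `v / ‖v‖` is completed to an orthonormal basis, whose coordinate map
preserves volume and the unit ball. -/
theorem setAverage_unitBall_abs_inner {d : ℕ} (hd : 1 ≤ d) (v : Rd d) :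
    ⨍ x in Metric.ball (0 : Rd d) 1, |inner ℝ v x| = firstAbsMoment d * ‖v‖ := by
  rcases eq_or_ne v 0 with rfl | hv
  · simp
  have hv0 : 0 < ‖v‖ := norm_pos_iff.2 hv
  let i : Fin d := ⟨0, hd⟩
  have hon : Orthonormal ℝ (({i} : Set (Fin d)).domRestrict fun _ => ‖v‖⁻¹ • v) := by
    rw [orthonormal_iff_ite]
    rintro ⟨j, hj⟩ ⟨k, hk⟩
    simp only [Set.mem_singleton_iff] at hj hk
    subst hj hk
    simp [Set.domRestrict, norm_smul, hv0.ne']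
  obtain ⟨b, hb⟩ := hon.exists_orthonormalBasis_extension_of_card_eq (by simp)
  have hbi : b i = ‖v‖⁻¹ • v := hb i rfl
  have hin : ∀ x, |inner ℝ v x| = ‖v‖ * |(b.repr x) i| := by
    intro x
    rw [b.repr_apply_apply, hbi, inner_smul_left, abs_mul]
    simp [abs_of_pos hv0]
    field_simp
  have h1 := b.measurePreserving_repr.setIntegral_preimage_emb
    b.repr.toHomeomorph.measurableEmbedding (fun x : Rd d => |x i|) (Metric.ball 0 1)
  have hpre : (b.repr ⁻¹' Metric.ball (0 : Rd d) 1) = Metric.ball 0 1 := by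
    ext x; simp
  rw [hpre] at h1
  simp_rw [hin]
  rw [setAverage_eq, integral_const_mul, h1, ← setAverage_unitBall_abs_coord i, setAverage_eq]
  simp only [smul_eq_mul]
  ring

/-- The integrand is odd and the ball is symmetric. -/
theorem setAverage_unitBall_inner {d : ℕ} (v : Rd d) :
    ⨍ x in Metric.ball (0 : Rd d) 1, inner ℝ v x = 0 := by
  have h1 := (Measure.measurePreserving_neg (volume : Measure (Rd d))).setIntegral_preimage_emb
    (MeasurableEquiv.neg (Rd d)).measurableEmbedding (fun x : Rd d => inner ℝ v x)
    (Metric.ball 0 1)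
  have hpre : (Neg.neg ⁻¹' Metric.ball (0 : Rd d) 1) = Metric.ball 0 1 := by
    ext x; simp
  rw [hpre] at h1
  simp only [inner_neg_right] at h1
  rw [integral_neg] at h1
  have : ∫ x in Metric.ball (0 : Rd d) 1, inner ℝ v x = 0 := by linarith
  rw [setAverage_eq, this, smul_zero]

theorem volume_ball_ne_zero {d : ℕ} (a : Rd d) {r : ℝ} (hr : 0 < r) :
    volume.real (Metric.ball a r) ≠ 0 :=
  (ENNReal.toReal_pos (Metric.measure_ball_pos _ _ hr).ne' measure_ball_lt_top.ne).ne'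

/-- A linear function has its value at the centre as mean over a ball. This is the model for `f`
near a Lebesgue point of its gradient. -/
theorem meanOsc_inner {d : ℕ} (hd : 1 ≤ d) (v a : Rd d) {r : ℝ} (hr : 0 < r) :
    meanOsc (fun x => inner ℝ v x) (a, r) = firstAbsMoment d * r * ‖v‖ := by
  have hm : ⨍ y in Metric.ball a r, inner ℝ v y = inner ℝ v a := by
    rw [setAverage_ball_eq_unitBall _ _ hr]
    simp only [inner_add_right, inner_smul_right]
    rw [setAverage_eq, integral_add, integral_const_mul]
    · have h := setAverage_unitBall_inner v
      rw [setAverage_eq, smul_eq_mul, mul_eq_zero, or_iff_right] at h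
      · rw [h, setIntegral_const, smul_eq_mul, smul_eq_mul]
        have := volume_ball_ne_zero (0 : Rd d) one_pos
        field_simp
        ring
      · exact inv_ne_zero (volume_ball_ne_zero _ one_pos)
    · exact integrableOn_const (by finiteness)
    · have : Continuous fun x : Rd d => r * inner ℝ v x := by fun_prop
      exact this.locallyIntegrable.integrableOn_isCompact (isCompact_closedBall 0 1)
        |>.mono_set Metric.ball_subset_closedBall
  unfold meanOsc
  simp only [hm]
  rw [setAverage_ball_eq_unitBall _ _ hr]
  simp only [inner_add_right, inner_smul_right, add_sub_cancel_left, abs_mul, abs_of_pos hr]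
  rw [setAverage_eq, integral_const_mul]
  have := setAverage_unitBall_abs_inner hd v
  rw [setAverage_eq] at this
  simp only [smul_eq_mul] at this ⊢
  rw [mul_left_comm, this]
  ring

/-! ### Weak derivatives along segments and the Poincaré inequality on balls. -/

theorem setLIntegral_ball_comp_add_le {d : ℕ} (G : Rd d → ENNReal) (h : Rd d) {R S : ℝ}
    (hRS : R + ‖h‖ ≤ S) :
    ∫⁻ x in Metric.ball 0 R, G (x + h) ≤ ∫⁻ x in Metric.ball 0 S, G x := by
  have := (measurePreserving_add_right (volume : Measure (Rd d)) h).setLIntegral_comp_preimage_emb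
    (measurableEmbedding_addRight h) G (Metric.ball 0 S)
  rw [← this]
  refine lintegral_mono_set fun x hx => ?_
  simp only [Set.mem_preimage, mem_ball_zero_iff] at hx ⊢
  linarith [norm_add_le x h]

/-- By Tonelli, since every translate of the ball of radius `R` stays in the ball of radius `R + c`.
It justifies Fubini for averages along segments (`τ t = t • h`) and over balls (`τ z = b + ε • z`).
-/
theorem integrable_translates {d : ℕ} {S : Type*} [MeasurableSpace S] {σ : Measure S}
    [IsFiniteMeasure σ] {τ : S → Rd d} (hτ : Measurable τ) {c : ℝ} (hc : ∀ᵐ s ∂σ, ‖τ s‖ ≤ c)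
    {G : Rd d → ℝ} (hGm : Measurable G) (hG : LocallyIntegrable G volume) (R : ℝ) :
    Integrable (fun q : Rd d × S => G (q.1 + τ q.2))
      ((volume.restrict (Metric.ball 0 R)).prod σ) := by
  have hm : Measurable fun q : Rd d × S => G (q.1 + τ q.2) := hGm.comp (by fun_prop)
  refine ⟨hm.aestronglyMeasurable, ?_⟩
  have hfin : ∫⁻ x in Metric.ball 0 (R + c), ‖G x‖ₑ < ⊤ :=
    (hG.integrableOn_isCompact (isCompact_closedBall 0 (R + c))
      |>.mono_set Metric.ball_subset_closedBall).2
  rw [hasFiniteIntegral_iff_enorm, lintegral_prod_symm _ hm.enorm.aemeasurable]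
  calc _ ≤ ∫⁻ _, ∫⁻ x in Metric.ball 0 (R + c), ‖G x‖ₑ ∂volume ∂σ := by
        refine lintegral_mono_ae ?_
        filter_upwards [hc] with s hs
        exact setLIntegral_ball_comp_add_le (fun x => ‖G x‖ₑ) (τ s) (by linarith)
    _ < ⊤ := by
        rw [lintegral_const]
        exact ENNReal.mul_lt_top hfin (measure_lt_top σ _)

theorem integrable_segment_translates {d : ℕ} {G : Rd d → ℝ} (hGm : Measurable G)
    (hG : LocallyIntegrable G volume) (h : Rd d) (R : ℝ) :
    Integrable (fun q : Rd d × ℝ => G (q.1 + q.2 • h))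
      ((volume.restrict (Metric.ball 0 R)).prod (volume.restrict (Set.Icc (0 : ℝ) 1))) := by
  refine integrable_translates (τ := fun t : ℝ => t • h) (by fun_prop) (c := ‖h‖) ?_ hGm hG R
  refine (ae_restrict_iff' measurableSet_Icc).2 (ae_of_all _ fun t ht => ?_)
  rw [norm_smul, Real.norm_eq_abs, abs_of_nonneg ht.1]
  nlinarith [norm_nonneg h, ht.2]

theorem exists_ball_of_hasCompactSupport {d : ℕ} {ψ : Rd d → ℝ} (hψ : HasCompactSupport ψ) :
    ∃ R : ℝ, 0 < R ∧ ∀ x, R ≤ ‖x‖ → x ∉ tsupport ψ := by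
  obtain ⟨R, hR⟩ := hψ.isBounded.subset_ball 0
  refine ⟨max R 1, by positivity, fun x hx hxs => ?_⟩
  have := hR hxs
  rw [mem_ball_zero_iff] at this
  linarith [le_max_left R 1]

theorem integral_eq_setIntegral_ball {d : ℕ} {F : Rd d → ℝ} {R : ℝ}
    (hF : ∀ x, R ≤ ‖x‖ → F x = 0) : ∫ x, F x = ∫ x in Metric.ball 0 R, F x := by
  refine (setIntegral_eq_integral_of_forall_compl_eq_zero fun x hx => hF x ?_).symm
  simpa using hx

/-- A function whose weak derivative in direction `h` is `G` has the increments predicted by the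
fundamental theorem of calculus. -/
theorem increment_eq_of_weak_directional_derivative {d : ℕ} {f G : Rd d → ℝ} {h : Rd d}
    (hf : LocallyIntegrable f volume)
    (hGm : Measurable G) (hG : LocallyIntegrable G volume)
    (hw : ∀ φ : Rd d → ℝ, ContDiff ℝ ∞ φ → HasCompactSupport φ →
      ∫ x, f x * fderiv ℝ φ x h = -∫ x, G x * φ x) :
    ∀ᵐ x, Integrable (fun t => G (x + t • h)) (volume.restrict (Set.Icc (0 : ℝ) 1)) ∧
      f (x + h) - f x = ∫ t in Set.Icc (0 : ℝ) 1, G (x + t • h) := by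
  have hfh : LocallyIntegrable (fun x => f (x + h)) volume := by
    refine (locallyIntegrable_iff (μ := volume)).2 fun K hK => ?_
    have h1 := hf.integrableOn_isCompact (hK.image (continuous_add_const h))
    have h2 := (measurePreserving_add_right (volume : Measure (Rd d)) h).integrableOn_image
      (measurableEmbedding_addRight h) (f := f) (s := K)
    exact h2.1 h1
  have hI : ∀ᵐ x, Integrable (fun t => G (x + t • h)) (volume.restrict (Set.Icc (0 : ℝ) 1)) := by
    have hn : ∀ n : ℕ, ∀ᵐ x, x ∈ Metric.ball (0 : Rd d) n →
        Integrable (fun t => G (x + t • h)) (volume.restrict (Set.Icc (0 : ℝ) 1)) := fun n =>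
      (ae_restrict_iff' Metric.isOpen_ball.measurableSet).1
        (integrable_segment_translates hGm hG h n).prod_right_ae
    filter_upwards [ae_all_iff.2 hn] with x hx
    obtain ⟨n, hn⟩ := exists_nat_gt ‖x‖
    exact hx n (by simpa using hn)
  have hLI : LocallyIntegrable (fun x => ∫ t in Set.Icc (0 : ℝ) 1, G (x + t • h)) volume := by
    refine (locallyIntegrable_iff (μ := volume)).2 fun K hK => ?_
    obtain ⟨R, hR⟩ := hK.isBounded.subset_ball 0
    exact IntegrableOn.mono_set
      (integrable_segment_translates hGm hG h R).integral_prod_left hR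
  -- Fundamental lemma of the calculus of variations: it suffices to test against smooth compactly
  -- supported `ψ`.
  have hD : ∀ᵐ x, f (x + h) - f x - ∫ t in Set.Icc (0 : ℝ) 1, G (x + t • h) = 0 := by
    refine ae_eq_zero_of_integral_contDiff_smul_eq_zero ((hfh.sub hf).sub hLI) ?_
    intro ψ hψ hψc
    obtain ⟨R, hR, hRs⟩ := exists_ball_of_hasCompactSupport hψc
    have hψ0 : ∀ x, R ≤ ‖x‖ → ψ x = 0 := fun x hx => image_eq_zero_of_notMem_tsupport (hRs x hx)
    have hDψ0 : ∀ x, R ≤ ‖x‖ → fderiv ℝ ψ x = 0 := fun x hx =>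
      image_eq_zero_of_notMem_tsupport fun hc => hRs x hx (tsupport_fderiv_subset ℝ hc)
    have hψcont := hψ.continuous
    have hDcont : Continuous (fderiv ℝ ψ) := hψ.continuous_fderiv (by simp)
    obtain ⟨Cψ, hCψ⟩ := hψc.exists_bound_of_continuous hψcont
    obtain ⟨CD, hCD⟩ := (hψc.fderiv ℝ).exists_bound_of_continuous hDcont
    have iψ : ∀ {u : Rd d → ℝ}, LocallyIntegrable u volume → Integrable (fun x => ψ x * u x) :=
      fun hu => hu.integrable_smul_left_of_hasCompactSupport hψcont hψc
    -- The increment is moved from `f` to `ψ`, where the classical fundamental theorem applies; for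
    -- each `t` the weak derivative hypothesis for `ψ (· - t • h)` brings in `G`, and a translation
    -- restores `ψ`.
    have key : ∫ x, ψ x * (f (x + h) - f x) =
        ∫ x, ψ x * ∫ t in Set.Icc (0 : ℝ) 1, G (x + t • h) := by
      have e1 : ∫ x, ψ x * (f (x + h) - f x) = ∫ x, f x * (ψ (x - h) - ψ x) := by
        have : ∫ x, ψ x * f (x + h) = ∫ x, ψ (x - h) * f x := by
          rw [← integral_add_right_eq_self (fun x => ψ (x - h) * f x) h]
          simp
        have i3 : Integrable fun x => ψ (x - h) * f x := by
          have := ((iψ hfh).comp_sub_right h)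
          simpa using this
        simp_rw [mul_sub]
        rw [integral_sub (iψ hfh) (iψ hf), this, ← integral_sub i3 (iψ hf)]
        exact integral_congr_ae (ae_of_all _ fun x => by ring)
      have e2 : ∀ x, ψ (x - h) - ψ x =
          ∫ t in Set.Icc (0 : ℝ) 1, -(fderiv ℝ ψ (x - t • h) h) := by
        intro x
        rw [integral_Icc_eq_integral_Ioc, ← intervalIntegral.integral_of_le zero_le_one]
        rw [intervalIntegral.integral_eq_sub_of_hasDerivAt
          (f := fun t : ℝ => ψ (x - t • h))]
        · simp
        · intro t _
          have h1 : HasDerivAt (fun t : ℝ => x - t • h) (-h) t := by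
            simpa using ((hasDerivAt_id t).smul_const h).const_sub x
          have h2 := ((hψ.differentiable (by simp)) (x - t • h)).hasFDerivAt.comp_hasDerivAt t h1
          rw [map_neg] at h2
          exact h2
        · exact Continuous.intervalIntegrable (by fun_prop) _ _
      -- All the translates `ψ (· - t • h)`, `0 ≤ t ≤ 1`, vanish outside the ball of radius `R +
      -- ‖h‖`, where `f` is integrable.
      have hS : ∀ x : Rd d, R + ‖h‖ ≤ ‖x‖ → ∀ t ∈ Set.Icc (0 : ℝ) 1, R ≤ ‖x - t • h‖ := by
        intro x hx t ht
        have h1 : ‖t • h‖ ≤ ‖h‖ := by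
          rw [norm_smul, Real.norm_eq_abs, abs_of_nonneg ht.1]
          nlinarith [norm_nonneg h, ht.2]
        linarith [norm_sub_norm_le x (t • h)]
      have e3 : ∫ x, f x * (ψ (x - h) - ψ x) =
          ∫ x in Metric.ball 0 (R + ‖h‖), ∫ t in Set.Icc (0 : ℝ) 1,
            -(f x * fderiv ℝ ψ (x - t • h) h) := by
        rw [integral_eq_setIntegral_ball (R := R + ‖h‖)]
        · refine integral_congr_ae (ae_of_all _ fun x => ?_)
          simp only
          rw [e2, ← integral_const_mul]
          simp only [mul_neg]
        · intro x hx
          have h0 := hψ0 _ (hS x hx 0 (by simp))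
          have h1 := hψ0 _ (hS x hx 1 (by simp))
          simp only [zero_smul, sub_zero, one_smul] at h0 h1
          simp [h0, h1]
      have i4 : Integrable (fun q : Rd d × ℝ => -(f q.1 * fderiv ℝ ψ (q.1 - q.2 • h) h))
          ((volume.restrict (Metric.ball 0 (R + ‖h‖))).prod
            (volume.restrict (Set.Icc (0 : ℝ) 1))) := by
        have hfi : Integrable f (volume.restrict (Metric.ball 0 (R + ‖h‖))) :=
          hf.integrableOn_isCompact (isCompact_closedBall 0 (R + ‖h‖))
            |>.mono_set Metric.ball_subset_closedBall
        have := (hfi.comp_fst (volume.restrict (Set.Icc (0 : ℝ) 1))).mul_bdd (c := CD * ‖h‖)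
          (g := fun q : Rd d × ℝ => fderiv ℝ ψ (q.1 - q.2 • h) h)
          (Continuous.aestronglyMeasurable (by fun_prop))
          (ae_of_all _ fun q => (ContinuousLinearMap.le_opNorm _ _).trans
            (mul_le_mul_of_nonneg_right (hCD _) (norm_nonneg _)))
        exact this.neg
      have e4 : ∀ t ∈ Set.Icc (0 : ℝ) 1, ∫ x in Metric.ball 0 (R + ‖h‖),
          -(f x * fderiv ℝ ψ (x - t • h) h) = ∫ x in Metric.ball 0 R, G (x + t • h) * ψ x := by
        intro t ht
        have h1 := hw (fun x => ψ (x - t • h)) (hψ.comp (by fun_prop))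
          (hψc.comp_homeomorph (Homeomorph.subRight (t • h)))
        have h2 : ∀ x, fderiv ℝ (fun x => ψ (x - t • h)) x = fderiv ℝ ψ (x - t • h) :=
          fun x => by
            simp only [sub_eq_add_neg, fderiv_comp_add_right]
        simp only [h2] at h1
        rw [integral_neg, ← integral_eq_setIntegral_ball, h1, neg_neg,
          ← integral_add_right_eq_self (fun x => G x * ψ (x - t • h)) (t • h),
          integral_eq_setIntegral_ball (R := R)]
        · simp
        · intro x hx
          simp [hψ0 x hx]
        · intro x hx
          simp [hDψ0 _ (hS x hx t ht)]
      rw [e1, e3, integral_integral_swap i4, setIntegral_congr_fun measurableSet_Icc e4,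
        integral_integral_swap]
      · rw [integral_eq_setIntegral_ball (R := R) (fun x hx => by simp [hψ0 x hx])]
        refine integral_congr_ae (ae_of_all _ fun x => ?_)
        simp only
        rw [integral_mul_const, mul_comm]
      · have := (integrable_segment_translates hGm hG h R).mul_bdd (c := Cψ)
          (g := fun q : Rd d × ℝ => ψ q.1) (Continuous.aestronglyMeasurable (by fun_prop))
          (ae_of_all _ fun q => hCψ _)
        exact this.swap
    simp only [smul_eq_mul]
    simp_rw [mul_sub _ (_ - _)]
    have i5 : Integrable fun x => ψ x * (f (x + h) - f x) := iψ (hfh.sub hf)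
    rw [integral_sub i5 (iψ hLI), key, sub_self]
  filter_upwards [hI, hD] with x h1 h2
  exact ⟨h1, by linarith⟩

theorem HasWeakGradient.directional {d : ℕ} {f : Rd d → ℝ} {g : Rd d → Rd d}
    (hf : LocallyIntegrable f volume) (hg : HasWeakGradient f g) (h : Rd d)
    {φ : Rd d → ℝ} (hφ : ContDiff ℝ ∞ φ) (hφc : HasCompactSupport φ) :
    ∫ x, f x * fderiv ℝ φ x h = -∫ x, inner ℝ (g x) h * φ x := by
  have hh : h = ∑ i, h i • (EuclideanSpace.single i (1 : ℝ) : Rd d) := by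
    ext j
    simp [Finset.sum_apply, Pi.single_apply]
  have hD : ∀ x, f x * fderiv ℝ φ x h =
      ∑ i, h i * (f x * fderiv ℝ φ x (EuclideanSpace.single i 1)) := by
    intro x
    conv_lhs => rw [hh]
    rw [map_sum, Finset.mul_sum]
    refine Finset.sum_congr rfl fun i _ => ?_
    rw [map_smul, smul_eq_mul]
    ring
  have hG : ∀ x, inner ℝ (g x) h * φ x = ∑ i, h i * (g x i * φ x) := by
    intro x
    rw [PiLp.inner_apply, Finset.sum_mul]
    refine Finset.sum_congr rfl fun i _ => ?_
    simp
    ring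
  simp_rw [hD, hG]
  rw [integral_finsetSum, integral_finsetSum, ← Finset.sum_neg_distrib]
  · refine Finset.sum_congr rfl fun i _ => ?_
    rw [integral_const_mul, integral_const_mul, hg.2 φ hφ hφc i]
    ring
  · intro i _
    refine Integrable.const_mul ?_ _
    have hgi : LocallyIntegrable (fun x => g x i) volume := by
      refine (locallyIntegrable_iff (μ := volume)).2 fun K hK => ?_
      have h1 := hg.1.integrableOn_isCompact hK
      exact ContinuousLinearMap.integrable_comp (EuclideanSpace.proj (𝕜 := ℝ) i) h1
    have := hgi.integrable_smul_left_of_hasCompactSupport hφ.continuous hφc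
    simpa [mul_comm] using this
  · intro i _
    refine Integrable.const_mul ?_ _
    have hc : Continuous fun x => fderiv ℝ φ x (EuclideanSpace.single i 1) :=
      (hφ.continuous_fderiv (by simp)).clm_apply continuous_const
    have := hf.integrable_smul_left_of_hasCompactSupport hc (hφc.fderiv_apply ℝ _)
    simpa [mul_comm] using this

/-- The vector `v` is subtracted from the gradient for later use: `v = 0` bounds `f` itself, and `v
= g a` compares `f` with its linear model at `a`. -/
theorem HasWeakGradient.enorm_increment_le {d : ℕ} {f : Rd d → ℝ} {g : Rd d → Rd d}
    (hf : LocallyIntegrable f volume) (hgm : Measurable g) (hg : HasWeakGradient f g)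
    (v h : Rd d) :
    ∀ᵐ x, ‖(f (x + h) - inner ℝ v (x + h)) - (f x - inner ℝ v x)‖ₑ ≤
      ‖h‖ₑ * ∫⁻ t in Set.Icc (0 : ℝ) 1, ‖g (x + t • h) - v‖ₑ := by
  have hGm : Measurable fun x => inner ℝ (g x) h := hgm.inner_const
  have hG : LocallyIntegrable (fun x => inner ℝ (g x) h) volume := by
    refine (locallyIntegrable_iff (μ := volume)).2 fun K hK => ?_
    have h1 : Integrable g (volume.restrict K) := hg.1.integrableOn_isCompact hK
    exact h1.inner_const h
  filter_upwards [increment_eq_of_weak_directional_derivative hf hGm hG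
    fun φ hφ hφc => hg.directional hf h hφ hφc] with x hx
  have e : (f (x + h) - inner ℝ v (x + h)) - (f x - inner ℝ v x) =
      ∫ t in Set.Icc (0 : ℝ) 1, inner ℝ (g (x + t • h) - v) h := by
    simp_rw [inner_sub_left]
    rw [integral_sub hx.1 (integrable_const _), ← hx.2]
    simp [inner_add_right]
    ring
  rw [e]
  refine (enorm_integral_le_lintegral_enorm _).trans ?_
  rw [← lintegral_const_mul' _ _ enorm_ne_top]
  refine lintegral_mono fun t => ?_
  rw [← ofReal_norm, ← ofReal_norm, ← ofReal_norm, ← ENNReal.ofReal_mul (norm_nonneg _)]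
  refine ENNReal.ofReal_le_ofReal ?_
  rw [mul_comm]
  exact norm_inner_le_norm _ _

/-- Put `y = x + h`, so `‖h‖ < 2r`. By convexity the segment from `x` to `x + h` stays in the ball,
and by translation invariance each `t` contributes at most the integral of `‖G‖` over the ball.
Integrating over `h` gives the volume factor. -/
theorem lintegral_ball_ball_enorm_sub_le {d : ℕ} {F : Rd d → ℝ} {G : Rd d → Rd d}
    (hFm : Measurable F) (hGm : Measurable G)
    (hinc : ∀ h, ∀ᵐ x, ‖F (x + h) - F x‖ₑ ≤
      ‖h‖ₑ * ∫⁻ t in Set.Icc (0 : ℝ) 1, ‖G (x + t • h)‖ₑ) (a : Rd d) (r : ℝ) :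
    ∫⁻ x in Metric.ball a r, ∫⁻ y in Metric.ball a r, ‖F y - F x‖ₑ ≤
      ENNReal.ofReal (2 * r) * volume (Metric.ball (0 : Rd d) (2 * r)) *
        ∫⁻ x in Metric.ball a r, ‖G x‖ₑ := by
  set B := Metric.ball a r with hB
  have hBm : MeasurableSet B := Metric.isOpen_ball.measurableSet
  set Φ : Rd d → Rd d → ENNReal := fun x h =>
    B.indicator (fun _ => B.indicator (fun y => ‖F y - F x‖ₑ) (x + h)) x with hΦ
  have hΦm : Measurable (Function.uncurry Φ) := by
    have hs : MeasurableSet {q : Rd d × Rd d | q.1 ∈ B ∧ q.1 + q.2 ∈ B} :=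
      (measurable_fst hBm).inter ((measurable_fst.add measurable_snd) hBm)
    have := Measurable.indicator (f := fun q : Rd d × Rd d => ‖F (q.1 + q.2) - F q.1‖ₑ)
      (by fun_prop) hs
    convert! this using 1
    ext q
    by_cases h1 : q.1 ∈ B <;> by_cases h2 : q.1 + q.2 ∈ B <;>
      simp [hΦ, Function.uncurry, h1, h2]
  have e1 : ∫⁻ x in B, ∫⁻ y in B, ‖F y - F x‖ₑ = ∫⁻ x, ∫⁻ h, Φ x h := by
    rw [← lintegral_indicator hBm]
    refine lintegral_congr fun x => ?_
    by_cases hx : x ∈ B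
    · simp only [hΦ, Set.indicator_of_mem hx]
      rw [lintegral_add_left_eq_self (fun y => B.indicator (fun y => ‖F y - F x‖ₑ) y) x,
        lintegral_indicator hBm]
    · simp [hΦ, hx]
  rw [e1, lintegral_lintegral_swap hΦm.aemeasurable]
  have e2 : ∀ h, ∫⁻ x, Φ x h ≤ (Metric.ball (0 : Rd d) (2 * r)).indicator
      (fun _ => ENNReal.ofReal (2 * r) * ∫⁻ x in B, ‖G x‖ₑ) h := by
    intro h
    by_cases hh : h ∈ Metric.ball (0 : Rd d) (2 * r)
    · rw [Set.indicator_of_mem hh]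
      rw [mem_ball_zero_iff] at hh
      calc ∫⁻ x, Φ x h ≤ ∫⁻ x, ENNReal.ofReal (2 * r) * ∫⁻ t in Set.Icc (0 : ℝ) 1,
            B.indicator (fun y => ‖G y‖ₑ) (x + t • h) := by
            refine lintegral_mono_ae ?_
            filter_upwards [hinc h] with x hx
            by_cases h1 : x ∈ B
            · by_cases h2 : x + h ∈ B
              · simp only [hΦ, Set.indicator_of_mem h1, Set.indicator_of_mem h2]
                refine hx.trans (mul_le_mul' ?_ ?_)
                · rw [← ofReal_norm]
                  exact ENNReal.ofReal_le_ofReal hh.le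
                · refine setLIntegral_mono' measurableSet_Icc fun t ht => ?_
                  rw [Set.indicator_of_mem]
                  have := (convex_ball a r).add_smul_sub_mem h1 h2 ht
                  rwa [add_sub_cancel_left] at this
              · simp [hΦ, h2]
            · simp [hΦ, h1]
        _ = ENNReal.ofReal (2 * r) * ∫⁻ t in Set.Icc (0 : ℝ) 1, ∫⁻ x,
            B.indicator (fun y => ‖G y‖ₑ) (x + t • h) := by
            have hm : Measurable fun q : Rd d × ℝ =>
                B.indicator (fun y => ‖G y‖ₑ) (q.1 + q.2 • h) :=
              (hGm.enorm.indicator hBm).comp (by fun_prop)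
            rw [lintegral_const_mul _ hm.lintegral_prod_right', lintegral_lintegral_swap]
            exact hm.aemeasurable
        _ = ENNReal.ofReal (2 * r) * ∫⁻ x in B, ‖G x‖ₑ := by
            congr 1
            have : ∀ t : ℝ, ∫⁻ x, B.indicator (fun y => ‖G y‖ₑ) (x + t • h) =
                ∫⁻ x in B, ‖G x‖ₑ := by
              intro t
              rw [lintegral_add_right_eq_self, lintegral_indicator hBm]
            simp [this]
    · rw [Set.indicator_of_notMem hh, nonpos_iff_eq_zero]
      have : ∀ x, Φ x h = 0 := by
        intro x
        by_cases h1 : x ∈ B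
        · by_cases h2 : x + h ∈ B
          · exfalso
            refine hh ?_
            rw [mem_ball_zero_iff]
            rw [hB, Metric.mem_ball] at h1 h2
            have := dist_triangle_right (x + h) x a
            rw [dist_eq_norm, add_sub_cancel_left] at this
            linarith
          · simp [hΦ, h2]
        · simp [hΦ, h1]
      simp [this]
  refine (lintegral_mono e2).trans ?_
  rw [lintegral_indicator Metric.isOpen_ball.measurableSet, setLIntegral_const]
  exact le_of_eq (by ring)

theorem integrableOn_ball_of_locallyIntegrable {d : ℕ} {E : Type*} [NormedAddCommGroup E]
    {F : Rd d → E} (hF : LocallyIntegrable F volume) (a : Rd d) (r : ℝ) :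
    IntegrableOn F (Metric.ball a r) :=
  (hF.integrableOn_isCompact (isCompact_closedBall a r)).mono_set Metric.ball_subset_closedBall

theorem meanOsc_eq {d : ℕ} (F : Rd d → ℝ) (a : Rd d) (r : ℝ) :
    meanOsc F (a, r) = (volume.real (Metric.ball a r))⁻¹ *
      ∫ x in Metric.ball a r, |F x - ⨍ y in Metric.ball a r, F y| := by
  unfold meanOsc
  rw [setAverage_eq _ (fun x => |F x - ⨍ y in Metric.ball a r, F y|), smul_eq_mul]

/-- A Poincaré inequality on balls, for functions whose increments are controlled by the integral
of a vector field along segments. -/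
theorem meanOsc_le_of_enorm_increment_le {d : ℕ} {F : Rd d → ℝ} {G : Rd d → Rd d}
    (hFm : Measurable F) (hF : LocallyIntegrable F volume)
    (hGm : Measurable G) (hG : LocallyIntegrable G volume)
    (hinc : ∀ h, ∀ᵐ x, ‖F (x + h) - F x‖ₑ ≤
      ‖h‖ₑ * ∫⁻ t in Set.Icc (0 : ℝ) 1, ‖G (x + t • h)‖ₑ) (a : Rd d) {r : ℝ} (hr : 0 < r) :
    meanOsc F (a, r) ≤ 2 ^ (d + 1) * r * ⨍ x in Metric.ball a r, ‖G x‖ := by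
  have hFB := integrableOn_ball_of_locallyIntegrable hF a r
  have hGB := integrableOn_ball_of_locallyIntegrable hG a r
  have key := lintegral_ball_ball_enorm_sub_le hFm hGm hinc a r
  set V := volume (Metric.ball a r) with hV
  have hV0 : V ≠ 0 := (Metric.measure_ball_pos _ _ hr).ne'
  have hVt : V ≠ ⊤ := measure_ball_lt_top.ne
  -- This `2^d`, with the bound `2r` on `‖h‖`, makes up the constant `2^(d+1) r`.
  have hV2 : volume (Metric.ball (0 : Rd d) (2 * r)) = ENNReal.ofReal (2 ^ d) * V := by
    rw [hV, Measure.addHaar_ball_of_pos _ _ (by positivity : 0 < 2 * r),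
      Measure.addHaar_ball_of_pos _ a hr, ← mul_assoc, ← ENNReal.ofReal_mul (by positivity)]
    simp [mul_pow]
  have hmean : ∀ x, ‖F x - ⨍ y in Metric.ball a r, F y‖ₑ ≤
      V⁻¹ * ∫⁻ y in Metric.ball a r, ‖F y - F x‖ₑ := by
    intro x
    have e : F x - ⨍ y in Metric.ball a r, F y =
        -((volume.real (Metric.ball a r))⁻¹ * ∫ y in Metric.ball a r, (F y - F x)) := by
      rw [integral_sub hFB (integrableOn_const measure_ball_lt_top.ne), setIntegral_const,
        setAverage_eq, smul_eq_mul, smul_eq_mul]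
      have := volume_ball_ne_zero a hr
      field_simp
      ring
    rw [e, enorm_neg, enorm_mul]
    refine mul_le_mul' (le_of_eq ?_) (enorm_integral_le_lintegral_enorm _)
    rw [Real.enorm_eq_ofReal (by positivity), measureReal_def, ← ENNReal.toReal_inv,
      ENNReal.ofReal_toReal (ENNReal.inv_ne_top.2 hV0)]
  have h1 : ∫⁻ x in Metric.ball a r, ‖F x - ⨍ y in Metric.ball a r, F y‖ₑ ≤
      ENNReal.ofReal (2 ^ (d + 1) * r) * ∫⁻ x in Metric.ball a r, ‖G x‖ₑ := by
    refine (lintegral_mono hmean).trans ?_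
    rw [lintegral_const_mul' _ _ (ENNReal.inv_ne_top.2 hV0)]
    refine (mul_le_mul_right key _).trans (le_of_eq ?_)
    rw [hV2, ← mul_assoc]
    congr 1
    rw [show V⁻¹ * (ENNReal.ofReal (2 * r) * (ENNReal.ofReal (2 ^ d) * V)) =
      (V⁻¹ * V) * (ENNReal.ofReal (2 ^ d) * ENNReal.ofReal (2 * r)) by ring,
      ENNReal.inv_mul_cancel hV0 hVt, one_mul, ← ENNReal.ofReal_mul (by positivity)]
    congr 1
    ring
  have h2 : ∫ x in Metric.ball a r, |F x - ⨍ y in Metric.ball a r, F y| ≤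
      2 ^ (d + 1) * r * ∫ x in Metric.ball a r, ‖G x‖ := by
    have i1 : IntegrableOn (fun x => F x - ⨍ y in Metric.ball a r, F y) (Metric.ball a r) :=
      hFB.sub (integrableOn_const measure_ball_lt_top.ne)
    rw [← ENNReal.ofReal_le_ofReal_iff (by positivity), ENNReal.ofReal_mul (by positivity),
      ofReal_integral_norm_eq_lintegral_enorm hGB]
    simp_rw [← Real.norm_eq_abs]
    rw [ofReal_integral_norm_eq_lintegral_enorm i1]
    exact h1
  rw [meanOsc_eq, setAverage_eq _ (fun x => ‖G x‖), smul_eq_mul, mul_left_comm]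
  exact mul_le_mul_of_nonneg_left h2 (by positivity)

theorem HasWeakGradient.meanOsc_sub_inner_le {d : ℕ} {f : Rd d → ℝ} {g : Rd d → Rd d}
    (hfm : Measurable f) (hf : LocallyIntegrable f volume) (hgm : Measurable g)
    (hg : HasWeakGradient f g) (v a : Rd d) {r : ℝ} (hr : 0 < r) :
    meanOsc (fun x => f x - inner ℝ v x) (a, r) ≤
      2 ^ (d + 1) * r * ⨍ x in Metric.ball a r, ‖g x - v‖ := by
  have hc : Continuous fun x : Rd d => inner ℝ v x := by fun_prop
  refine meanOsc_le_of_enorm_increment_le (hfm.sub hc.measurable) (hf.sub hc.locallyIntegrable)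
    (hgm.sub_const v) (hg.1.sub (locallyIntegrable_const v))
    (fun h => hg.enorm_increment_le hf hgm v h) a hr

theorem meanOsc_nonneg {d : ℕ} (F : Rd d → ℝ) (a : Rd d) (r : ℝ) : 0 ≤ meanOsc F (a, r) := by
  rw [meanOsc_eq]
  positivity

/-- On a fixed ball the oscillation is a seminorm, hence obeys the reverse triangle inequality. -/
theorem abs_meanOsc_sub_meanOsc_le {d : ℕ} {F H : Rd d → ℝ} (hF : LocallyIntegrable F volume)
    (hH : LocallyIntegrable H volume) (a : Rd d) (r : ℝ) :
    |meanOsc F (a, r) - meanOsc H (a, r)| ≤ meanOsc (fun x => F x - H x) (a, r) := by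
  have hFB := integrableOn_ball_of_locallyIntegrable hF a r
  have hHB := integrableOn_ball_of_locallyIntegrable hH a r
  have hc : ∀ c : ℝ, IntegrableOn (fun _ : Rd d => c) (Metric.ball a r) := fun c =>
    integrableOn_const measure_ball_lt_top.ne
  have e : ⨍ y in Metric.ball a r, (F y - H y) =
      (⨍ y in Metric.ball a r, F y) - ⨍ y in Metric.ball a r, H y := by
    rw [setAverage_eq, setAverage_eq, setAverage_eq, integral_sub hFB hHB, smul_sub]
  simp only [meanOsc_eq, e]
  have i1 : ∀ {u : Rd d → ℝ}, IntegrableOn u (Metric.ball a r) → ∀ c : ℝ,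
      IntegrableOn (fun x => |u x - c|) (Metric.ball a r) := fun hu c => (hu.sub (hc c)).abs
  rw [← mul_sub, ← integral_sub (i1 hFB _) (i1 hHB _), abs_mul,
    abs_of_nonneg (by positivity)]
  refine mul_le_mul_of_nonneg_left (abs_integral_le_integral_abs.trans ?_) (by positivity)
  refine integral_mono_of_nonneg (ae_of_all _ fun x => abs_nonneg _)
    (i1 (hFB.sub hHB) _) (ae_of_all _ fun x => ?_)
  refine (abs_abs_sub_abs_le _ _).trans (le_of_eq ?_)
  congr 1
  ring

/-! ### Lebesgue points and the oscillation on small balls. -/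

theorem ae_tendsto_setAverage_ball_norm_sub {d : ℕ} (hd : 1 ≤ d) {g : Rd d → Rd d}
    (hg : LocallyIntegrable g volume) :
    ∀ᵐ a, Tendsto (fun r => ⨍ x in Metric.ball a r, ‖g x - g a‖) (𝓝[>] 0) (𝓝 0) := by
  have : Nonempty (Fin d) := ⟨⟨0, hd⟩⟩
  filter_upwards [IsUnifLocDoublingMeasure.ae_tendsto_average_norm_sub volume hg 1] with a ha
  have h := ha (l := 𝓝[>] (0 : ℝ)) (fun _ => a) id tendsto_id
    (by filter_upwards [self_mem_nhdsWithin] with r hr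
        simpa using (Set.mem_Ioi.1 hr).le)
  refine h.congr fun r => ?_
  refine setAverage_congr ?_
  -- The differentiation theorem concerns closed balls; spheres are null sets.
  exact (ae_eq_of_subset_of_measure_ge Metric.ball_subset_closedBall
    (Measure.addHaar_closedBall_eq_addHaar_ball volume a r).le
    Metric.isOpen_ball.measurableSet.nullMeasurableSet measure_closedBall_lt_top.ne).symm

/-- Compare `f` with `⟨g a, ·⟩`: by Poincaré with `v = g a`, their oscillations differ by at most
`2^(d+1) r` times a mean that tends to `0`. -/
theorem HasWeakGradient.tendsto_meanOsc_div {d : ℕ} (hd : 1 ≤ d) {f : Rd d → ℝ}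
    {g : Rd d → Rd d} (hfm : Measurable f) (hf : LocallyIntegrable f volume) (hgm : Measurable g)
    (hg : HasWeakGradient f g) {a : Rd d}
    (ha : Tendsto (fun r => ⨍ x in Metric.ball a r, ‖g x - g a‖) (𝓝[>] 0) (𝓝 0)) :
    Tendsto (fun r => meanOsc f (a, r) / r) (𝓝[>] 0) (𝓝 (firstAbsMoment d * ‖g a‖)) := by
  rw [tendsto_iff_norm_sub_tendsto_zero]
  have h2 := ha.const_mul ((2 : ℝ) ^ (d + 1))
  rw [mul_zero] at h2
  refine squeeze_zero' (Eventually.of_forall fun r => norm_nonneg _) ?_ h2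
  filter_upwards [self_mem_nhdsWithin] with r hr
  have hr : 0 < r := hr
  have hc : Continuous fun x : Rd d => inner ℝ (g a) x := by fun_prop
  have h1 := (abs_meanOsc_sub_meanOsc_le hf hc.locallyIntegrable a r).trans
    (hg.meanOsc_sub_inner_le hfm hf hgm (g a) a hr)
  rw [meanOsc_inner hd _ _ hr] at h1
  have e : meanOsc f (a, r) / r - firstAbsMoment d * ‖g a‖ =
      (meanOsc f (a, r) - firstAbsMoment d * r * ‖g a‖) / r := by
    field_simp
  rw [e, Real.norm_eq_abs, abs_div, abs_of_pos hr, div_le_iff₀ hr]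
  linarith

/-! ### Measurability, and the half-space measure with its scaling. -/

theorem measurable_setAverage_ball {d : ℕ} {Ψ : (Rd d × ℝ) × Rd d → ℝ} (hΨ : Measurable Ψ) :
    Measurable fun q : Rd d × ℝ => ⨍ x in Metric.ball q.1 q.2, Ψ (q, x) := by
  have hs : MeasurableSet {w : (Rd d × ℝ) × Rd d | w.2 ∈ Metric.ball w.1.1 w.1.2} := by
    simp only [Metric.mem_ball]
    exact measurableSet_lt (by fun_prop) (by fun_prop)
  have h_int : ∀ {Θ : (Rd d × ℝ) × Rd d → ℝ}, Measurable Θ →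
      Measurable fun q : Rd d × ℝ => ∫ x in Metric.ball q.1 q.2, Θ (q, x) := by
    intro Θ hΘ
    have h1 := ((hΘ.indicator hs).stronglyMeasurable.integral_prod_right'
      (ν := (volume : Measure (Rd d)))).measurable
    convert! h1 using 1
    ext q
    rw [← integral_indicator Metric.isOpen_ball.measurableSet]
    rfl
  have h1 := h_int (Θ := fun _ => 1) measurable_const
  simp only [setIntegral_const, smul_eq_mul, mul_one] at h1
  simp only [setAverage_eq]
  exact h1.inv.smul (h_int hΨ)

theorem measurable_meanOsc {d : ℕ} {f : Rd d → ℝ} (hf : Measurable f) : Measurable (meanOsc f) := by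
  have h1 : Measurable fun q : Rd d × ℝ => ⨍ x in Metric.ball q.1 q.2, f x :=
    measurable_setAverage_ball (Ψ := fun w => f w.2) (hf.comp measurable_snd)
  exact measurable_setAverage_ball
    (Ψ := fun w => |f w.2 - ⨍ y in Metric.ball w.1.1 w.1.2, f y|)
    (by
      have h2 : Measurable fun w : (Rd d × ℝ) × Rd d => f w.2 := hf.comp measurable_snd
      have h3 : Measurable fun w : (Rd d × ℝ) × Rd d => ⨍ y in Metric.ball w.1.1 w.1.2, f y :=
        h1.comp measurable_fst
      exact measurable_norm.comp (h2.sub h3))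

theorem meanOsc_congr_ae {d : ℕ} {f f' : Rd d → ℝ} (h : f =ᵐ[volume] f') :
    meanOsc f = meanOsc f' := by
  ext q
  have hr : ∀ s : Set (Rd d), f =ᵐ[volume.restrict s] f' := fun s => ae_restrict_of_ae h
  have h1 : ⨍ y in Metric.ball q.1 q.2, f y = ⨍ y in Metric.ball q.1 q.2, f' y :=
    average_congr (hr _)
  unfold meanOsc
  rw [h1]
  refine average_congr ?_
  filter_upwards [hr (Metric.ball q.1 q.2)] with x hx
  rw [hx]

theorem measurable_halfSpace_density (p : ℝ) :
    Measurable fun ρ : ℝ => ENNReal.ofReal (1 / ρ ^ (p + 1)) := by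
  fun_prop

theorem lintegral_halfSpaceMeasure {d : ℕ} (p : ℝ) {F : Rd d × ℝ → ENNReal} (hF : Measurable F) :
    ∫⁻ q, F q ∂halfSpaceMeasure d p =
      ∫⁻ ρ in Set.Ioi (0 : ℝ), ∫⁻ a, ENNReal.ofReal (1 / ρ ^ (p + 1)) * F (a, ρ) := by
  have hw : Measurable fun q : Rd d × ℝ => ENNReal.ofReal (1 / q.2 ^ (p + 1)) := by fun_prop
  have hs : {q : Rd d × ℝ | 0 < q.2} = Set.univ ×ˢ Set.Ioi 0 := by
    ext q; simp
  rw [halfSpaceMeasure, lintegral_withDensity_eq_lintegral_mul _ hw hF, hs, Measure.volume_eq_prod,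
    ← Measure.prod_restrict, Measure.restrict_univ, lintegral_prod_symm _ (by fun_prop)]
  rfl

theorem lintegral_halfSpaceMeasure_symm {d : ℕ} (p : ℝ) {F : Rd d × ℝ → ENNReal}
    (hF : Measurable F) :
    ∫⁻ q, F q ∂halfSpaceMeasure d p =
      ∫⁻ a, ∫⁻ ρ in Set.Ioi (0 : ℝ), ENNReal.ofReal (1 / ρ ^ (p + 1)) * F (a, ρ) := by
  rw [lintegral_halfSpaceMeasure p hF, lintegral_lintegral_swap]
  exact Measurable.aemeasurable (((measurable_halfSpace_density p).comp measurable_fst).mul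
    (hF.comp measurable_swap))

theorem lintegral_Ioi_comp_mul_left (Φ : ℝ → ENNReal) {κ : ℝ} (hκ : 0 < κ) :
    ∫⁻ r in Set.Ioi (0 : ℝ), Φ r = ENNReal.ofReal κ * ∫⁻ ρ in Set.Ioi (0 : ℝ), Φ (κ * ρ) := by
  have h := lintegral_image_eq_lintegral_abs_deriv_mul (s := Set.Ioi (0 : ℝ))
    (f := fun ρ => κ * ρ) (f' := fun _ => κ) measurableSet_Ioi
    (fun x _ => by simpa using ((hasDerivAt_id x).const_mul κ).hasDerivWithinAt)
    (fun x _ y _ hxy => mul_left_cancel₀ hκ.ne' hxy) Φ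
  have him : (fun ρ => κ * ρ) '' Set.Ioi (0 : ℝ) = Set.Ioi 0 := by
    simpa using Set.image_mul_left_Ioi hκ 0
  rw [him, abs_of_pos hκ, lintegral_const_mul' _ _ ENNReal.ofReal_ne_top] at h
  exact h

/-- The measure `dr / r^(p+1)` is homogeneous of degree `-p` under `r = κρ`. -/
theorem lintegral_halfSpaceMeasure_comp_mul {d : ℕ} (p : ℝ) {F : Rd d × ℝ → ENNReal}
    (hF : Measurable F) {κ : ℝ} (hκ : 0 < κ) :
    ENNReal.ofReal (κ ^ p) * ∫⁻ q, F q ∂halfSpaceMeasure d p =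
      ∫⁻ q, F (q.1, κ * q.2) ∂halfSpaceMeasure d p := by
  rw [lintegral_halfSpaceMeasure p hF, lintegral_halfSpaceMeasure p (F := fun q => F (q.1, κ * q.2))
    (hF.comp (by fun_prop)), lintegral_Ioi_comp_mul_left _ hκ, ← mul_assoc,
    ← lintegral_const_mul' _ _ (by finiteness)]
  refine setLIntegral_congr_fun measurableSet_Ioi fun ρ hρ => ?_
  have hρ : 0 < ρ := hρ
  simp only
  rw [← lintegral_const_mul' _ _ (by finiteness)]
  refine lintegral_congr fun a => ?_
  rw [← mul_assoc, ← ENNReal.ofReal_mul (by positivity), ← ENNReal.ofReal_mul (by positivity),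
    Real.mul_rpow hκ.le hρ.le, Real.rpow_add hκ, Real.rpow_one]
  congr 2
  field_simp

/-- After this change of variables the measure is fixed and only the set depends on `κ`, so limit
theorems for integrals apply. -/
theorem scaled_superlevel_meanOsc {d : ℕ} (p : ℝ) {f : Rd d → ℝ} (hf : Measurable f) {κ : ℝ}
    (hκ : 0 < κ) :
    ENNReal.ofReal (κ ^ p) * halfSpaceMeasure d p {q | κ < meanOsc f q} =
      halfSpaceMeasure d p {q | κ < meanOsc f (q.1, κ * q.2)} := by
  have hs : MeasurableSet {q | κ < meanOsc f q} :=
    measurableSet_lt measurable_const (measurable_meanOsc hf)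
  have hs' : MeasurableSet {q : Rd d × ℝ | κ < meanOsc f (q.1, κ * q.2)} :=
    measurableSet_lt measurable_const ((measurable_meanOsc hf).comp (by fun_prop))
  rw [← lintegral_indicator_one hs, ← lintegral_indicator_one hs',
    lintegral_halfSpaceMeasure_comp_mul p (measurable_one.indicator hs) hκ]
  rfl

theorem lintegral_Ioi_inv_rpow {q c : ℝ} (hq : 0 < q) (hc : 0 < c) :
    ∫⁻ ρ in Set.Ioi c⁻¹, ENNReal.ofReal (1 / ρ ^ (q + 1)) = ENNReal.ofReal (c ^ q / q) := by
  have hpos : ∀ ρ ∈ Set.Ioi c⁻¹, 0 < ρ := fun ρ hρ => (inv_pos.2 hc).trans hρ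
  have e : ∀ ρ ∈ Set.Ioi c⁻¹, ENNReal.ofReal (1 / ρ ^ (q + 1)) =
      ENNReal.ofReal (ρ ^ (-q - 1)) := by
    intro ρ hρ
    rw [show -q - 1 = -(q + 1) by ring, Real.rpow_neg (hpos ρ hρ).le, one_div]
  rw [setLIntegral_congr_fun measurableSet_Ioi e, ← ofReal_integral_eq_lintegral_ofReal
    (integrableOn_Ioi_rpow_of_lt (by linarith) (inv_pos.2 hc)),
    integral_Ioi_rpow_of_lt (by linarith) (inv_pos.2 hc)]
  · congr 1
    rw [show -q - 1 + 1 = -q by ring, Real.inv_rpow hc.le, Real.rpow_neg hc.le, inv_inv]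
    field_simp
  · refine (ae_restrict_iff' measurableSet_Ioi).2 (ae_of_all _ fun ρ hρ => ?_)
    exact Real.rpow_nonneg (hpos ρ hρ).le _

theorem lintegral_indicator_one_lt_mul {q c : ℝ} (hq : 0 < q) (hc : 0 ≤ c) :
    ∫⁻ ρ in Set.Ioi (0 : ℝ), ENNReal.ofReal (1 / ρ ^ (q + 1)) *
      {ρ : ℝ | 1 < ρ * c}.indicator 1 ρ = ENNReal.ofReal (c ^ q / q) := by
  rcases hc.eq_or_lt with rfl | hc
  · simp [Real.zero_rpow hq.ne']
  rw [← lintegral_Ioi_inv_rpow hq hc, ← lintegral_indicator measurableSet_Ioi,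
    ← lintegral_indicator measurableSet_Ioi]
  refine lintegral_congr fun ρ => ?_
  have h1 : 1 < ρ * c ↔ c⁻¹ < ρ := by rw [inv_lt_iff_one_lt_mul₀ hc]
  by_cases h : c⁻¹ < ρ
  · have : 0 < ρ := (inv_pos.2 hc).trans h
    simp [Set.indicator, h1, h, this]
  · simp [Set.indicator, h1, h]

/-- Integrate in `ρ` first: the integral of `ρ^(-p-1)` over `ρ > 1/s` is `s^p / p`, with `s = c ‖g
a‖`. For `c = firstAbsMoment d` the factor is `limitConst d p`. -/
theorem halfSpaceMeasure_one_lt_mul {d : ℕ} {p : ℝ} (hp : 0 < p) {g : Rd d → Rd d}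
    (hg : Measurable g) {c : ℝ} (hc : 0 ≤ c) :
    halfSpaceMeasure d p {q | 1 < q.2 * (c * ‖g q.1‖)} =
      ENNReal.ofReal (p⁻¹ * c ^ p) * ∫⁻ a, ‖g a‖ₑ ^ p := by
  have hs : MeasurableSet {q : Rd d × ℝ | 1 < q.2 * (c * ‖g q.1‖)} :=
    measurableSet_lt measurable_const (by fun_prop)
  rw [← lintegral_indicator_one hs, lintegral_halfSpaceMeasure_symm p (measurable_one.indicator hs),
    ← lintegral_const_mul' _ _ ENNReal.ofReal_ne_top]
  refine lintegral_congr fun a => ?_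
  have := lintegral_indicator_one_lt_mul hp (mul_nonneg hc (norm_nonneg (g a)))
  refine this.trans ?_
  rw [← ofReal_norm, ENNReal.ofReal_rpow_of_nonneg (norm_nonneg _) hp.le,
    ← ENNReal.ofReal_mul (by positivity), Real.mul_rpow hc (norm_nonneg _)]
  congr 1
  field_simp

theorem ae_halfSpaceMeasure_fst {d : ℕ} {p : ℝ} {P : Rd d → Prop} (hP : ∀ᵐ a, P a) :
    ∀ᵐ q ∂halfSpaceMeasure d p, P q.1 := by
  have h1 : ∀ᵐ q : Rd d × ℝ, P q.1 := Measure.quasiMeasurePreserving_fst.ae hP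
  exact (withDensity_absolutelyContinuous _ _).ae_le (ae_restrict_of_ae h1)

theorem ae_halfSpaceMeasure_pos {d : ℕ} {p : ℝ} : ∀ᵐ q ∂halfSpaceMeasure d p, 0 < q.2 := by
  have hs : MeasurableSet {q : Rd d × ℝ | 0 < q.2} := measurableSet_lt (by fun_prop) (by fun_prop)
  exact (withDensity_absolutelyContinuous _ _).ae_le (ae_restrict_mem hs)

/-! ### Dominated convergence with varying majorants. -/

/-- The negative parts `H₀ - H i` are dominated by `H₀`, so their integrals vanish in the limit. As
the integral of `H i` is at most that of `H₀`, the positive parts have no larger integral than the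
negative ones. -/
theorem tendsto_lintegral_tsub_of_lintegral_le {α ι : Type*} [MeasurableSpace α] {μ : Measure α}
    {l : Filter ι} [l.IsCountablyGenerated] {H : ι → α → ENNReal} {H₀ : α → ENNReal}
    (hm : ∀ᶠ i in l, Measurable (H i)) (hm₀ : Measurable H₀)
    (hle : ∀ᶠ i in l, ∫⁻ x, H i x ∂μ ≤ ∫⁻ x, H₀ x ∂μ) (hfin : ∫⁻ x, H₀ x ∂μ ≠ ⊤)
    (hlim : ∀ᵐ x ∂μ, Tendsto (fun i => H i x) l (𝓝 (H₀ x))) :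
    Tendsto (fun i => ∫⁻ x, (H i x - H₀ x) ∂μ) l (𝓝 0) := by
  have h1 : Tendsto (fun i => ∫⁻ x, (H₀ x - H i x) ∂μ) l (𝓝 0) := by
    rw [← lintegral_zero (μ := μ)]
    refine tendsto_lintegral_filter_of_dominated_convergence H₀ ?_ ?_ hfin ?_
    · filter_upwards [hm] with i hi using hm₀.sub hi
    · exact Eventually.of_forall fun i => ae_of_all _ fun x => tsub_le_self
    · filter_upwards [hlim, ae_lt_top hm₀ hfin] with x hx hxt
      have := ENNReal.Tendsto.sub (tendsto_const_nhds (x := H₀ x)) hx (Or.inl hxt.ne)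
      rwa [tsub_self] at this
  refine tendsto_of_tendsto_of_tendsto_of_le_of_le' tendsto_const_nhds h1
    (Eventually.of_forall fun _ => zero_le) ?_
  filter_upwards [hm, hle] with i hi hlei
  have e : ∫⁻ x, H i x ∂μ + ∫⁻ x, (H₀ x - H i x) ∂μ = ∫⁻ x, H₀ x ∂μ + ∫⁻ x, (H i x - H₀ x) ∂μ := by
    rw [← lintegral_add_left hi, ← lintegral_add_left hm₀]
    refine lintegral_congr fun x => ?_
    rcases le_total (H i x) (H₀ x) with h | h
    · rw [add_tsub_cancel_of_le h, tsub_eq_zero_of_le h, add_zero]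
    · rw [add_tsub_cancel_of_le h, tsub_eq_zero_of_le h, add_zero]
  refine (ENNReal.add_le_add_iff_left hfin).1 ?_
  rw [← e]
  exact add_le_add_left hlei _

/-- Dominated convergence with convergent dominating functions. -/
theorem tendsto_lintegral_of_tendsto_dominating {α ι : Type*} [MeasurableSpace α] {μ : Measure α}
    {l : Filter ι} [l.IsCountablyGenerated] [l.NeBot] {I H : ι → α → ENNReal}
    {I₀ H₀ : α → ENNReal}
    (hI : ∀ᶠ i in l, Measurable (I i)) (hm : ∀ᶠ i in l, Measurable (H i)) (hm₀ : Measurable H₀)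
    (hdom : ∀ᶠ i in l, ∀ᵐ x ∂μ, I i x ≤ H i x)
    (hle : ∀ᶠ i in l, ∫⁻ x, H i x ∂μ ≤ ∫⁻ x, H₀ x ∂μ) (hfin : ∫⁻ x, H₀ x ∂μ ≠ ⊤)
    (hlim : ∀ᵐ x ∂μ, Tendsto (fun i => H i x) l (𝓝 (H₀ x)))
    (hlimI : ∀ᵐ x ∂μ, Tendsto (fun i => I i x) l (𝓝 (I₀ x)))
    (hle₀ : ∀ᵐ x ∂μ, I₀ x ≤ H₀ x) :
    Tendsto (fun i => ∫⁻ x, I i x ∂μ) l (𝓝 (∫⁻ x, I₀ x ∂μ)) := by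
  have h1 := tendsto_lintegral_tsub_of_lintegral_le hm hm₀ hle hfin hlim
  -- Truncation at `H₀` allows ordinary dominated convergence; what is cut off is at most `H i -
  -- H₀`, which `h1` makes negligible.
  have h2 : Tendsto (fun i => ∫⁻ x, min (I i x) (H₀ x) ∂μ) l (𝓝 (∫⁻ x, I₀ x ∂μ)) := by
    refine tendsto_lintegral_filter_of_dominated_convergence H₀ ?_ ?_ hfin ?_
    · filter_upwards [hI] with i hi using hi.min hm₀
    · exact Eventually.of_forall fun i => ae_of_all _ fun x => min_le_right _ _
    · filter_upwards [hlimI, hle₀] with x hx hx0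
      have := hx.min (tendsto_const_nhds (x := H₀ x))
      rwa [min_eq_left hx0] at this
  have h3 := h2.add h1
  rw [add_zero] at h3
  refine tendsto_of_tendsto_of_tendsto_of_le_of_le' h2 h3
    (Eventually.of_forall fun i => lintegral_mono fun x => min_le_left _ _) ?_
  filter_upwards [hI, hdom] with i hi hd
  rw [← lintegral_add_left (hi.min hm₀)]
  refine lintegral_mono_ae ?_
  filter_upwards [hd] with x hx
  rcases le_total (I i x) (H₀ x) with h | h
  · rw [min_eq_left h]
    exact le_self_add
  · rw [min_eq_right h]
    calc I i x ≤ H i x := hx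
      _ ≤ H₀ x + (H i x - H₀ x) := le_add_tsub

/-! ### Rescaled superlevel sets: the two bounds and the limit. -/

section Superlevel

variable {d : ℕ} {f : Rd d → ℝ} {g : Rd d → Rd d}

theorem HasWeakGradient.tendsto_meanOsc_scaled_div (hd : 1 ≤ d) (hfm : Measurable f)
    (hf : LocallyIntegrable f volume) (hgm : Measurable g) (hg : HasWeakGradient f g) {a : Rd d}
    (ha : Tendsto (fun r => ⨍ x in Metric.ball a r, ‖g x - g a‖) (𝓝[>] 0) (𝓝 0))
    {ρ : ℝ} (hρ : 0 < ρ) :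
    Tendsto (fun κ => meanOsc f (a, κ * ρ) / κ) (𝓝[>] 0)
      (𝓝 (ρ * (firstAbsMoment d * ‖g a‖))) := by
  have h1 : Tendsto (fun κ : ℝ => κ * ρ) (𝓝[>] 0) (𝓝[>] 0) := by
    refine tendsto_nhdsWithin_iff.2 ⟨?_, ?_⟩
    · have : Tendsto (fun κ : ℝ => κ * ρ) (𝓝 0) (𝓝 (0 * ρ)) := tendsto_id.mul_const ρ
      rw [zero_mul] at this
      exact this.mono_left nhdsWithin_le_nhds
    · filter_upwards [self_mem_nhdsWithin] with κ hκ using mul_pos hκ hρ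
  refine (((hg.tendsto_meanOsc_div hd hfm hf hgm ha).comp h1).const_mul ρ).congr fun κ => ?_
  simp only [Function.comp]
  field_simp

/-- Off the critical value `1` the strict inequality holds or fails for all small `κ`, so the
indicators are eventually constant. -/
theorem HasWeakGradient.tendsto_indicator_superlevel (hd : 1 ≤ d) (hfm : Measurable f)
    (hf : LocallyIntegrable f volume) (hgm : Measurable g) (hg : HasWeakGradient f g)
    {q : Rd d × ℝ}
    (ha : Tendsto (fun r => ⨍ x in Metric.ball q.1 r, ‖g x - g q.1‖) (𝓝[>] 0) (𝓝 0))
    (hρ : 0 < q.2) (hne : q.2 * (firstAbsMoment d * ‖g q.1‖) ≠ 1) :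
    Tendsto (fun κ => {q | κ < meanOsc f (q.1, κ * q.2)}.indicator (1 : Rd d × ℝ → ENNReal) q)
      (𝓝[>] 0)
      (𝓝 ({q | 1 < q.2 * (firstAbsMoment d * ‖g q.1‖)}.indicator (1 : Rd d × ℝ → ENNReal) q)) := by
  have h := hg.tendsto_meanOsc_scaled_div hd hfm hf hgm ha hρ
  refine tendsto_nhds_of_eventually_eq ?_
  rcases hne.lt_or_gt with hlt | hgt
  · filter_upwards [h.eventually_lt_const hlt, self_mem_nhdsWithin] with κ h1 hκ
    have hκ : 0 < κ := hκ
    rw [div_lt_one hκ] at h1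
    simp [Set.indicator, h1.not_gt, hlt.not_gt]
  · filter_upwards [h.eventually_const_lt hgt, self_mem_nhdsWithin] with κ h1 hκ
    have hκ : 0 < κ := hκ
    rw [one_lt_div hκ] at h1
    simp [Set.indicator, h1, hgt]

/-- Each centre excludes at most one radius. -/
theorem ae_halfSpaceMeasure_mul_ne_one {p : ℝ} (hgm : Measurable g) (c : ℝ) :
    ∀ᵐ q ∂halfSpaceMeasure d p, q.2 * (c * ‖g q.1‖) ≠ 1 := by
  have hs : MeasurableSet {q : Rd d × ℝ | q.2 * (c * ‖g q.1‖) = 1} :=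
    measurableSet_eq_fun (by fun_prop) measurable_const
  rw [ae_iff]
  simp only [not_not]
  rw [← lintegral_indicator_one hs, lintegral_halfSpaceMeasure_symm p (measurable_one.indicator hs)]
  refine (lintegral_congr fun a => ?_).trans lintegral_zero
  refine lintegral_eq_zero_of_ae_eq_zero (ae_restrict_of_ae ?_)
  have : ∀ᵐ ρ : ℝ, ρ ≠ (c * ‖g a‖)⁻¹ := by
    rw [ae_iff]
    simp
  filter_upwards [this] with ρ hρ
  have : ρ * (c * ‖g a‖) ≠ 1 := fun h => hρ (eq_inv_of_mul_eq_one_left h)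
  simp [Set.indicator, this]

theorem measurableSet_scaled_superlevel (hfm : Measurable f) (κ : ℝ) :
    MeasurableSet {q : Rd d × ℝ | κ < meanOsc f (q.1, κ * q.2)} :=
  measurableSet_lt measurable_const ((measurable_meanOsc hfm).comp (by fun_prop))

theorem HasWeakGradient.ae_tendsto_indicator_superlevel (hd : 1 ≤ d) (p : ℝ) (hfm : Measurable f)
    (hf : LocallyIntegrable f volume) (hgm : Measurable g) (hg : HasWeakGradient f g) :
    ∀ᵐ q ∂halfSpaceMeasure d p,
      Tendsto (fun κ => {q | κ < meanOsc f (q.1, κ * q.2)}.indicator (1 : Rd d × ℝ → ENNReal) q)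
      (𝓝[>] 0)
      (𝓝 ({q | 1 < q.2 * (firstAbsMoment d * ‖g q.1‖)}.indicator (1 : Rd d × ℝ → ENNReal) q)) := by
  filter_upwards [ae_halfSpaceMeasure_fst (ae_tendsto_setAverage_ball_norm_sub hd hg.1),
    ae_halfSpaceMeasure_pos, ae_halfSpaceMeasure_mul_ne_one hgm (firstAbsMoment d)] with q h1 h2 h3
  exact hg.tendsto_indicator_superlevel hd hfm hf hgm h1 h2 h3

/-- Fatou's lemma along `κ n = 1 / (n + 1)`. No integrability of `‖g‖^p` enters, so finiteness of
the right side can be used to prove it. -/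
theorem HasWeakGradient.limitConst_mul_le_iSup (hd : 1 ≤ d) {p : ℝ} (hp : 0 < p)
    (hfm : Measurable f) (hf : LocallyIntegrable f volume) (hgm : Measurable g)
    (hg : HasWeakGradient f g) :
    ENNReal.ofReal (limitConst d p) * ∫⁻ a, ‖g a‖ₑ ^ p ≤
      ⨆ (κ : ℝ) (_ : 0 < κ),
        ENNReal.ofReal (κ ^ p) * halfSpaceMeasure d p {q | κ < meanOsc f q} := by
  have hc := (firstAbsMoment_pos d).le
  have e : ENNReal.ofReal (limitConst d p) * ∫⁻ a, ‖g a‖ₑ ^ p =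
      halfSpaceMeasure d p {q | 1 < q.2 * (firstAbsMoment d * ‖g q.1‖)} :=
    (halfSpaceMeasure_one_lt_mul hp hgm hc).symm
  have hs : MeasurableSet {q : Rd d × ℝ | 1 < q.2 * (firstAbsMoment d * ‖g q.1‖)} :=
    measurableSet_lt measurable_const (by fun_prop)
  let κ : ℕ → ℝ := fun n => 1 / ((n : ℝ) + 1)
  have hκ : ∀ n, 0 < κ n := fun n => by positivity
  have hκlim : Tendsto κ atTop (𝓝[>] 0) :=
    tendsto_nhdsWithin_iff.2 ⟨tendsto_one_div_add_atTop_nhds_zero_nat, Eventually.of_forall hκ⟩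
  rw [e, ← lintegral_indicator_one hs]
  calc _ = ∫⁻ q, liminf (fun n => {q | κ n < meanOsc f (q.1, κ n * q.2)}.indicator
          (1 : Rd d × ℝ → ENNReal) q) atTop ∂halfSpaceMeasure d p := by
        refine lintegral_congr_ae ?_
        filter_upwards [hg.ae_tendsto_indicator_superlevel hd p hfm hf hgm] with q hq
        exact (hq.comp hκlim).liminf_eq.symm
    _ ≤ liminf (fun n => ∫⁻ q, {q | κ n < meanOsc f (q.1, κ n * q.2)}.indicator
          (1 : Rd d × ℝ → ENNReal) q ∂halfSpaceMeasure d p) atTop :=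
        lintegral_liminf_le fun n =>
          measurable_one.indicator (measurableSet_scaled_superlevel hfm (κ n))
    _ ≤ _ := by
        refine liminf_le_of_le (by isBoundedDefault) fun b hb => ?_
        obtain ⟨n, hn⟩ := hb.exists
        refine hn.trans ?_
        rw [lintegral_indicator_one (measurableSet_scaled_superlevel hfm (κ n)),
          ← scaled_superlevel_meanOsc p hfm (hκ n)]
        exact le_iSup₂_of_le (κ n) (hκ n) le_rfl

/-- The mean over the ball `B_{κρ}(a)` of the positive part of `2^(d+2) ρ |g| - 1`; it dominates
the indicator function of a rescaled superlevel set of the mean oscillation. -/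
noncomputable def excessMean (g : Rd d → Rd d) (κ : ℝ) (q : Rd d × ℝ) : ℝ :=
  ⨍ x in Metric.ball q.1 (κ * q.2), max (2 ^ (d + 2) * q.2 * ‖g x‖ - 1) 0

theorem measurable_excessMean (hgm : Measurable g) {κ : ℝ} (hκ : 0 < κ) :
    Measurable (excessMean g κ) := by
  -- The general lemma sees only the radius `κρ` of the ball, so `ρ` is recovered by dividing by
  -- `κ`.
  have h := (measurable_setAverage_ball
    (Ψ := fun w : (Rd d × ℝ) × Rd d => max (2 ^ (d + 2) * (w.1.2 / κ) * ‖g w.2‖ - 1) 0)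
    (by fun_prop)).comp (g := _) (f := fun q : Rd d × ℝ => (q.1, κ * q.2)) (by fun_prop)
  convert! h using 1
  ext q
  simp only [excessMean, Function.comp]
  rw [mul_div_cancel_left₀ _ hκ.ne']

theorem integrableOn_ball_excess (hg : LocallyIntegrable g volume) (ρ : ℝ) (a : Rd d) (r : ℝ) :
    IntegrableOn (fun x => max (2 ^ (d + 2) * ρ * ‖g x‖ - 1) 0) (Metric.ball a r) := by
  have h1 := (integrableOn_ball_of_locallyIntegrable hg a r).norm.const_mul (2 ^ (d + 2) * ρ)
  have h2 : IntegrableOn (fun _ : Rd d => (1 : ℝ)) (Metric.ball a r) :=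
    integrableOn_const measure_ball_lt_top.ne
  exact (h1.sub h2).pos_part

/-- Poincaré with `v = 0` gives that the mean of `2^(d+1) ρ ‖g‖` exceeds `1`; doubling it leaves
more than `1` after subtracting `1`. The subtraction makes the majorant's integrand vanish for small
`ρ ‖g‖`, without which the integral against `ρ^(-p-1)` would diverge at `ρ = 0`. -/
theorem HasWeakGradient.indicator_superlevel_le (hfm : Measurable f)
    (hf : LocallyIntegrable f volume) (hgm : Measurable g) (hg : HasWeakGradient f g)
    {κ : ℝ} (hκ : 0 < κ) {q : Rd d × ℝ} (hq : 0 < q.2) :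
    {q | κ < meanOsc f (q.1, κ * q.2)}.indicator (1 : Rd d × ℝ → ENNReal) q ≤
      ENNReal.ofReal (excessMean g κ q) := by
  refine Set.indicator_apply_le' (fun hmem => ?_) (fun _ => zero_le)
  obtain ⟨a, ρ⟩ := q
  simp only [Set.mem_ofPred_eq] at hmem hq
  have hr : 0 < κ * ρ := by positivity
  have h1 := hg.meanOsc_sub_inner_le hfm hf hgm 0 a hr
  simp only [inner_zero_left, sub_zero] at h1
  have h2 : κ < 2 ^ (d + 1) * (κ * ρ) * ⨍ x in Metric.ball a (κ * ρ), ‖g x‖ := hmem.trans_le h1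
  have h3 : 1 < 2 ^ (d + 1) * ρ * ⨍ x in Metric.ball a (κ * ρ), ‖g x‖ := by
    refine lt_of_mul_lt_mul_left ?_ hκ.le
    calc κ * 1 = κ := mul_one κ
      _ < _ := h2
      _ = _ := by ring
  simp only [Pi.one_apply, ENNReal.one_le_ofReal, excessMean]
  have i0 := (integrableOn_ball_of_locallyIntegrable hg.1 a (κ * ρ)).norm.const_mul
    (2 ^ (d + 2) * ρ)
  have i2 : IntegrableOn (fun _ : Rd d => (1 : ℝ)) (Metric.ball a (κ * ρ)) :=
    integrableOn_const measure_ball_lt_top.ne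
  have h4 : ⨍ x in Metric.ball a (κ * ρ), (2 ^ (d + 2) * ρ * ‖g x‖ - 1) ≤
      ⨍ x in Metric.ball a (κ * ρ), max (2 ^ (d + 2) * ρ * ‖g x‖ - 1) 0 := by
    rw [setAverage_eq, setAverage_eq]
    refine smul_le_smul_of_nonneg_left ?_ (by positivity)
    exact integral_mono (i0.sub i2) (integrableOn_ball_excess hg.1 ρ a (κ * ρ))
      fun x => le_max_left _ _
  have h5 : ⨍ x in Metric.ball a (κ * ρ), (2 ^ (d + 2) * ρ * ‖g x‖ - 1) =
      2 ^ (d + 2) * ρ * (⨍ x in Metric.ball a (κ * ρ), ‖g x‖) - 1 := by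
    have hv := volume_ball_ne_zero a hr
    rw [setAverage_eq, setAverage_eq, integral_sub i0 i2, integral_const_mul, setIntegral_const]
    simp only [smul_eq_mul]
    field_simp
  rw [h5] at h4
  refine le_trans ?_ h4
  rw [pow_succ]
  linarith

/-- Tonelli: the centres `a` with `x ∈ B_r(a)` form a ball of the same volume. -/
theorem lintegral_setAverage_ball {u : Rd d → ℝ} (hum : Measurable u) (hu : LocallyIntegrable u volume)
    (hu0 : ∀ x, 0 ≤ u x) {r : ℝ} (hr : 0 < r) :
    ∫⁻ a, ENNReal.ofReal (⨍ x in Metric.ball a r, u x) = ∫⁻ x, ENNReal.ofReal (u x) := by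
  set V := volume (Metric.ball (0 : Rd d) r) with hV
  have hV0 : V ≠ 0 := (Metric.measure_ball_pos _ _ hr).ne'
  have hVt : V ≠ ⊤ := measure_ball_lt_top.ne
  have hVa : ∀ a : Rd d, volume (Metric.ball a r) = V := fun a =>
    Measure.addHaar_ball_center volume a r
  have e : ∀ a, ENNReal.ofReal (⨍ x in Metric.ball a r, u x) =
      V⁻¹ * ∫⁻ x, (Metric.ball a r).indicator (fun x => ENNReal.ofReal (u x)) x := by
    intro a
    rw [setAverage_eq, smul_eq_mul, ENNReal.ofReal_mul (by positivity), measureReal_def, hVa,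
      ← ENNReal.toReal_inv, ENNReal.ofReal_toReal (ENNReal.inv_ne_top.2 hV0),
      ofReal_integral_eq_lintegral_ofReal (integrableOn_ball_of_locallyIntegrable hu a r)
        (ae_of_all _ hu0), lintegral_indicator Metric.isOpen_ball.measurableSet]
  have hm : Measurable (Function.uncurry fun a x : Rd d =>
      (Metric.ball a r).indicator (fun x => ENNReal.ofReal (u x)) x) := by
    have hs : MeasurableSet {w : Rd d × Rd d | dist w.2 w.1 < r} :=
      measurableSet_lt (by fun_prop) measurable_const
    exact Measurable.indicator (f := fun w : Rd d × Rd d => ENNReal.ofReal (u w.2))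
      (by fun_prop) hs
  simp_rw [e]
  rw [lintegral_const_mul' _ _ (ENNReal.inv_ne_top.2 hV0),
    lintegral_lintegral_swap hm.aemeasurable]
  have e2 : ∀ x, ∫⁻ a, (Metric.ball a r).indicator (fun x => ENNReal.ofReal (u x)) x =
      V * ENNReal.ofReal (u x) := by
    intro x
    have : ∀ a, (Metric.ball a r).indicator (fun x => ENNReal.ofReal (u x)) x =
        (Metric.ball x r).indicator (fun _ => ENNReal.ofReal (u x)) a := by
      intro a
      simp [Set.indicator, dist_comm]
    simp_rw [this]
    rw [lintegral_indicator Metric.isOpen_ball.measurableSet, setLIntegral_const, hVa, mul_comm]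
  simp_rw [e2]
  rw [lintegral_const_mul' _ _ hVt, ← mul_assoc, ENNReal.inv_mul_cancel hV0 hVt, one_mul]

/-- At fixed `ρ`, averaging over balls preserves the integral in `a`. The independence of `κ` yields
both the uniform upper bound and majorants of constant integral. -/
theorem lintegral_excessMean (p : ℝ) (hgm : Measurable g) (hg : LocallyIntegrable g volume)
    {κ : ℝ} (hκ : 0 < κ) :
    ∫⁻ q, ENNReal.ofReal (excessMean g κ q) ∂halfSpaceMeasure d p =
      ∫⁻ q, ENNReal.ofReal (2 ^ (d + 2) * q.2 * ‖g q.1‖ - 1) ∂halfSpaceMeasure d p := by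
  rw [lintegral_halfSpaceMeasure p (measurable_excessMean hgm hκ).ennreal_ofReal,
    lintegral_halfSpaceMeasure p (by fun_prop)]
  refine setLIntegral_congr_fun measurableSet_Ioi fun ρ hρ => ?_
  have hρ : 0 < ρ := hρ
  simp only
  rw [lintegral_const_mul' _ _ ENNReal.ofReal_ne_top, lintegral_const_mul' _ _ ENNReal.ofReal_ne_top]
  congr 1
  have hli : LocallyIntegrable (fun x => max (2 ^ (d + 2) * ρ * ‖g x‖ - 1) 0) volume := by
    refine (locallyIntegrable_iff (μ := volume)).2 fun K hK => ?_
    obtain ⟨R, hR⟩ := hK.isBounded.subset_ball 0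
    exact (integrableOn_ball_excess hg ρ 0 R).mono_set hR
  have h := lintegral_setAverage_ball (u := fun x => max (2 ^ (d + 2) * ρ * ‖g x‖ - 1) 0)
    (by fun_prop) hli (fun x => le_max_right _ _) (mul_pos hκ hρ)
  refine h.trans (lintegral_congr fun x => ?_)
  simp [ENNReal.ofReal_max]

/-- Use `(cρ - 1)₊ ≤ cρ` on `cρ > 1`. The extra `ρ` lowers the exponent from `p` to `p - 1`, hence
the need for `p > 1` and the factor `1 / (p - 1)`. -/
theorem lintegral_excess_le {p : ℝ} (hp : 1 < p) (hgm : Measurable g) :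
    ∫⁻ q, ENNReal.ofReal (2 ^ (d + 2) * q.2 * ‖g q.1‖ - 1) ∂halfSpaceMeasure d p ≤
      ENNReal.ofReal ((2 ^ (d + 2)) ^ p / (p - 1)) * ∫⁻ a, ‖g a‖ₑ ^ p := by
  rw [lintegral_halfSpaceMeasure_symm p (by fun_prop),
    ← lintegral_const_mul' _ _ ENNReal.ofReal_ne_top]
  refine lintegral_mono fun a => ?_
  set c : ℝ := 2 ^ (d + 2) * ‖g a‖ with hc
  have hc0 : 0 ≤ c := by positivity
  have h := lintegral_indicator_one_lt_mul (q := p - 1) (by linarith) hc0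
  calc _ ≤ ∫⁻ ρ in Set.Ioi (0 : ℝ), ENNReal.ofReal c * (ENNReal.ofReal (1 / ρ ^ (p - 1 + 1)) *
        {ρ : ℝ | 1 < ρ * c}.indicator 1 ρ) := by
        refine setLIntegral_mono' measurableSet_Ioi fun ρ hρ => ?_
        have hρ : 0 < ρ := hρ
        by_cases h1 : 1 < ρ * c
        · have : ρ ∈ {ρ : ℝ | 1 < ρ * c} := h1
          rw [Set.indicator_of_mem this, Pi.one_apply, mul_one,
            ← ENNReal.ofReal_mul (by positivity), ← ENNReal.ofReal_mul hc0]
          refine ENNReal.ofReal_le_ofReal ?_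
          rw [sub_add_cancel, Real.rpow_add hρ, Real.rpow_one]
          have h2 : 2 ^ (d + 2) * ρ * ‖g a‖ - 1 ≤ c * ρ := by rw [hc]; nlinarith
          calc _ ≤ 1 / (ρ ^ p * ρ) * (c * ρ) := by gcongr
            _ = c * (1 / ρ ^ p) := by field_simp
        · rw [ENNReal.ofReal_of_nonpos (p := 2 ^ (d + 2) * ρ * ‖g a‖ - 1)]
          · simp
          · have : 2 ^ (d + 2) * ρ * ‖g a‖ = ρ * c := by rw [hc]; ring
            linarith
    _ = ENNReal.ofReal c * ENNReal.ofReal (c ^ (p - 1) / (p - 1)) := by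
        rw [lintegral_const_mul' _ _ ENNReal.ofReal_ne_top, h]
    _ = _ := by
        rw [← ofReal_norm, ENNReal.ofReal_rpow_of_nonneg (norm_nonneg _) (by linarith),
          ← ENNReal.ofReal_mul hc0, ← ENNReal.ofReal_mul
            (div_nonneg (by positivity) (by linarith))]
        congr 1
        have h3 : c * c ^ (p - 1) = c ^ p := by
          rcases hc0.eq_or_lt with h0 | h0
          · rw [← h0, zero_mul, Real.zero_rpow (by linarith)]
          · rw [Real.rpow_sub h0, Real.rpow_one]
            field_simp
        rw [← mul_div_assoc, h3, hc, Real.mul_rpow (by positivity) (norm_nonneg _)]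
        ring

theorem HasWeakGradient.scaled_superlevel_le {p : ℝ} (hp : 1 < p)
    (hfm : Measurable f) (hf : LocallyIntegrable f volume) (hgm : Measurable g)
    (hg : HasWeakGradient f g) {κ : ℝ} (hκ : 0 < κ) :
    ENNReal.ofReal (κ ^ p) * halfSpaceMeasure d p {q | κ < meanOsc f q} ≤
      ENNReal.ofReal ((2 ^ (d + 2)) ^ p / (p - 1)) * ∫⁻ a, ‖g a‖ₑ ^ p := by
  rw [scaled_superlevel_meanOsc p hfm hκ,
    ← lintegral_indicator_one (measurableSet_scaled_superlevel hfm κ)]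
  refine (lintegral_mono_ae ?_).trans
    ((lintegral_excessMean p hgm hg.1 hκ).le.trans (lintegral_excess_le hp hgm))
  filter_upwards [ae_halfSpaceMeasure_pos] with q hq
  exact hg.indicator_superlevel_le hfm hf hgm hκ hq

/-- The map `t ↦ max (A t - 1) 0` is `A`-Lipschitz for `A ≥ 0`, so Lebesgue points of `g` are
inherited. -/
theorem tendsto_excessMean (hg : LocallyIntegrable g volume) {q : Rd d × ℝ} (hq : 0 < q.2)
    (ha : Tendsto (fun r => ⨍ x in Metric.ball q.1 r, ‖g x - g q.1‖) (𝓝[>] 0) (𝓝 0)) :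
    Tendsto (fun κ => excessMean g κ q) (𝓝[>] 0)
      (𝓝 (max (2 ^ (d + 2) * q.2 * ‖g q.1‖ - 1) 0)) := by
  obtain ⟨a, ρ⟩ := q
  simp only at hq ha ⊢
  set A : ℝ := 2 ^ (d + 2) * ρ with hA
  have hA0 : 0 ≤ A := by positivity
  have h1 : Tendsto (fun κ : ℝ => κ * ρ) (𝓝[>] 0) (𝓝[>] 0) := by
    refine tendsto_nhdsWithin_iff.2 ⟨?_, ?_⟩
    · have : Tendsto (fun κ : ℝ => κ * ρ) (𝓝 0) (𝓝 (0 * ρ)) := tendsto_id.mul_const ρ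
      rw [zero_mul] at this
      exact this.mono_left nhdsWithin_le_nhds
    · filter_upwards [self_mem_nhdsWithin] with κ hκ using mul_pos hκ hq
  have h2 := (ha.comp h1).const_mul A
  rw [mul_zero] at h2
  rw [tendsto_iff_norm_sub_tendsto_zero]
  refine squeeze_zero' (Eventually.of_forall fun κ => norm_nonneg _) ?_ h2
  filter_upwards [self_mem_nhdsWithin] with κ hκ
  have hr : 0 < κ * ρ := mul_pos hκ hq
  have i1 := integrableOn_ball_excess hg ρ a (κ * ρ)
  rw [← hA] at i1
  have ic : ∀ c : ℝ, IntegrableOn (fun _ : Rd d => c) (Metric.ball a (κ * ρ)) := fun c =>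
    integrableOn_const measure_ball_lt_top.ne
  have i2 : IntegrableOn (fun x => ‖g x - g a‖) (Metric.ball a (κ * ρ)) :=
    ((integrableOn_ball_of_locallyIntegrable hg a (κ * ρ)).sub
      (integrableOn_const measure_ball_lt_top.ne)).norm
  set m := max (A * ‖g a‖ - 1) 0 with hm
  have e : excessMean g κ (a, ρ) - m = (volume.real (Metric.ball a (κ * ρ)))⁻¹ *
      ∫ x in Metric.ball a (κ * ρ), (max (A * ‖g x‖ - 1) 0 - m) := by
    have hv := volume_ball_ne_zero a hr
    rw [integral_sub i1 (ic _), setIntegral_const, excessMean, setAverage_eq]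
    simp only [smul_eq_mul, ← hA]
    field_simp
  simp only [Function.comp]
  rw [e, norm_mul, Real.norm_of_nonneg (by positivity), setAverage_eq, smul_eq_mul, mul_left_comm]
  refine mul_le_mul_of_nonneg_left ?_ (by positivity)
  rw [← integral_const_mul]
  refine norm_integral_le_of_norm_le (i2.const_mul A) (ae_of_all _ fun x => ?_)
  rw [Real.norm_eq_abs, hm]
  refine (abs_max_sub_max_le_abs _ _ _).trans ?_
  rw [show A * ‖g x‖ - 1 - (A * ‖g a‖ - 1) = A * (‖g x‖ - ‖g a‖) by ring, abs_mul,
    abs_of_nonneg hA0]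
  exact mul_le_mul_of_nonneg_left (abs_norm_sub_norm_le _ _) hA0

theorem HasWeakGradient.tendsto_scaled_superlevel (hd : 1 ≤ d) {p : ℝ} (hp : 1 < p)
    (hfm : Measurable f) (hf : LocallyIntegrable f volume) (hgm : Measurable g)
    (hg : HasWeakGradient f g) (hfin : ∫⁻ a, ‖g a‖ₑ ^ p ≠ ⊤) :
    Tendsto
      (fun κ : ℝ => ENNReal.ofReal (κ ^ p) * halfSpaceMeasure d p {q | κ < meanOsc f q})
      (𝓝[>] 0) (𝓝 (ENNReal.ofReal (limitConst d p) * ∫⁻ a, ‖g a‖ₑ ^ p)) := by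
  have hc := (firstAbsMoment_pos d).le
  have e : ENNReal.ofReal (limitConst d p) * ∫⁻ a, ‖g a‖ₑ ^ p =
      halfSpaceMeasure d p {q | 1 < q.2 * (firstAbsMoment d * ‖g q.1‖)} :=
    (halfSpaceMeasure_one_lt_mul (by linarith) hgm hc).symm
  have hs : MeasurableSet {q : Rd d × ℝ | 1 < q.2 * (firstAbsMoment d * ‖g q.1‖)} :=
    measurableSet_lt measurable_const (by fun_prop)
  rw [e, ← lintegral_indicator_one hs]
  have hκpos : ∀ᶠ κ : ℝ in 𝓝[>] 0, 0 < κ := self_mem_nhdsWithin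
  have hlimI := hg.ae_tendsto_indicator_superlevel hd p hfm hf hgm
  have hlimH : ∀ᵐ q ∂halfSpaceMeasure d p, Tendsto (fun κ => ENNReal.ofReal (excessMean g κ q))
      (𝓝[>] 0) (𝓝 (ENNReal.ofReal (2 ^ (d + 2) * q.2 * ‖g q.1‖ - 1))) := by
    filter_upwards [ae_halfSpaceMeasure_fst (ae_tendsto_setAverage_ball_norm_sub hd hg.1),
      ae_halfSpaceMeasure_pos] with q h1 h2
    have := ENNReal.tendsto_ofReal (tendsto_excessMean hg.1 h2 h1)
    simpa [ENNReal.ofReal_max] using this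
  have hdom : ∀ᶠ κ : ℝ in 𝓝[>] 0, ∀ q : Rd d × ℝ, 0 < q.2 →
      {q | κ < meanOsc f (q.1, κ * q.2)}.indicator (1 : Rd d × ℝ → ENNReal) q ≤
      ENNReal.ofReal (excessMean g κ q) := by
    filter_upwards [hκpos] with κ hκ q hq
    exact hg.indicator_superlevel_le hfm hf hgm hκ hq
  have key := tendsto_lintegral_of_tendsto_dominating (μ := halfSpaceMeasure d p)
    (l := 𝓝[>] (0 : ℝ))
    (I := fun κ => {q | κ < meanOsc f (q.1, κ * q.2)}.indicator (1 : Rd d × ℝ → ENNReal))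
    (H := fun κ q => ENNReal.ofReal (excessMean g κ q))
    (H₀ := fun q => ENNReal.ofReal (2 ^ (d + 2) * q.2 * ‖g q.1‖ - 1))
    (I₀ := {q | 1 < q.2 * (firstAbsMoment d * ‖g q.1‖)}.indicator (1 : Rd d × ℝ → ENNReal))
    (Eventually.of_forall fun κ => measurable_one.indicator (measurableSet_scaled_superlevel hfm κ))
    (by filter_upwards [hκpos] with κ hκ using (measurable_excessMean hgm hκ).ennreal_ofReal)
    (by fun_prop)
    (by
      filter_upwards [hdom] with κ hκ
      filter_upwards [ae_halfSpaceMeasure_pos] with q hq using hκ q hq)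
    (by filter_upwards [hκpos] with κ hκ using (lintegral_excessMean p hgm hg.1 hκ).le)
    ((lintegral_excess_le hp hgm).trans_lt
      (ENNReal.mul_lt_top ENNReal.ofReal_lt_top hfin.lt_top)).ne
    hlimH hlimI
    (by
      -- The limits inherit the domination that holds for every small `κ`.
      filter_upwards [hlimH, hlimI, ae_halfSpaceMeasure_pos] with q h1 h2 hq
      refine le_of_tendsto_of_tendsto h2 h1 ?_
      filter_upwards [hdom] with κ hκ using hκ q hq)
  refine key.congr' ?_
  filter_upwards [hκpos] with κ hκ
  rw [scaled_superlevel_meanOsc p hfm hκ,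
    lintegral_indicator_one (measurableSet_scaled_superlevel hfm κ)]

end Superlevel

/-! ### Weak compactness in `L¹` from a weak `L^p` bound. -/

section WeakCompactness

variable {α : Type*} [MeasurableSpace α] {μ : Measure α}

/-- Layer cake split at height `s`: below it each level set has measure at most `μ E`, above it the
weak bound is integrated, and the integral of `t^(-p)` over `t > s` converges as `p > 1`. -/
theorem setLIntegral_enorm_le_of_weak_bound {p : ℝ} (hp : 1 < p) {u : α → ℝ} (hu : Measurable u)
    {B : ENNReal} (hB : ∀ t : ℝ, 0 < t → ENNReal.ofReal (t ^ p) * μ {x | t < |u x|} ≤ B)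
    (E : Set α) {s : ℝ} (hs : 0 < s) :
    ∫⁻ x in E, ‖u x‖ₑ ∂μ ≤
      ENNReal.ofReal s * μ E + B * ENNReal.ofReal (s⁻¹ ^ (p - 1) / (p - 1)) := by
  have e : ∫⁻ x in E, ‖u x‖ₑ ∂μ = ∫⁻ x in E, ENNReal.ofReal |u x| ∂μ :=
    lintegral_congr fun x => by rw [← Real.norm_eq_abs, ofReal_norm]
  have hu' : Measurable fun x => |u x| := measurable_norm.comp hu
  rw [e, lintegral_eq_lintegral_meas_lt _ (ae_of_all _ fun x => abs_nonneg _) hu'.aemeasurable,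
    ← Set.Ioc_union_Ioi_eq_Ioi hs.le,
    lintegral_union measurableSet_Ioi (Set.Ioc_disjoint_Ioi le_rfl)]
  refine add_le_add ?_ ?_
  · calc _ ≤ ∫⁻ _ in Set.Ioc 0 s, μ E := by
          refine lintegral_mono fun t => ?_
          exact (measure_mono (Set.subset_univ _)).trans (by simp)
      _ = _ := by simp [mul_comm]
  · have h := lintegral_Ioi_inv_rpow (q := p - 1) (by linarith) (inv_pos.2 hs)
    rw [inv_inv, sub_add_cancel] at h
    rw [← h, ← lintegral_const_mul _ (by fun_prop)]
    refine setLIntegral_mono' measurableSet_Ioi fun t ht => ?_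
    have ht : 0 < t := hs.trans ht
    have htp : 0 < t ^ p := Real.rpow_pos_of_pos ht p
    refine (Measure.restrict_apply_le _ _).trans ?_
    rw [one_div, ENNReal.ofReal_inv_of_pos htp, ← div_eq_mul_inv,
      ENNReal.le_div_iff_mul_le (Or.inl (by simpa using htp)) (Or.inl ENNReal.ofReal_ne_top), mul_comm]
    exact hB t ht

/-- Choose `s` so large that the levels above `s` contribute less than `ε / 2`, then `δ = ε / (2s)`;
neither depends on `n`. -/
theorem exists_pos_forall_setLIntegral_le_of_weak_bound {ι : Type*} {p : ℝ} (hp : 1 < p)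
    {u : ι → α → ℝ} (hu : ∀ n, Measurable (u n)) {B : ENNReal} (hBt : B ≠ ⊤)
    (hB : ∀ n, ∀ t : ℝ, 0 < t → ENNReal.ofReal (t ^ p) * μ {x | t < |u n x|} ≤ B)
    {ε : ℝ} (hε : 0 < ε) :
    ∃ δ : ENNReal, 0 < δ ∧ ∀ n E, μ E ≤ δ → ∫⁻ x in E, ‖u n x‖ₑ ∂μ ≤ ENNReal.ofReal ε := by
  have h1 : Tendsto (fun s : ℝ => s⁻¹ ^ (p - 1) / (p - 1)) atTop (𝓝 0) := by
    have h := (tendsto_rpow_neg_atTop (y := p - 1) (by linarith)).div_const (p - 1)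
    rw [zero_div] at h
    refine h.congr' ?_
    filter_upwards [eventually_gt_atTop 0] with s hs
    rw [Real.rpow_neg hs.le, Real.inv_rpow hs.le]
  have h2 := ENNReal.Tendsto.const_mul (a := B) (ENNReal.tendsto_ofReal h1) (Or.inr hBt)
  rw [ENNReal.ofReal_zero, mul_zero] at h2
  have hε2 : (0 : ENNReal) < ENNReal.ofReal (ε / 2) := by simpa using hε
  obtain ⟨s, hs1, hs2⟩ := ((h2.eventually_lt_const hε2).and (eventually_gt_atTop 0)).exists
  refine ⟨ENNReal.ofReal (ε / 2 / s), by simpa using div_pos (half_pos hε) hs2, fun n E hE => ?_⟩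
  refine (setLIntegral_enorm_le_of_weak_bound hp (hu n) (hB n) E hs2).trans ?_
  calc _ ≤ ENNReal.ofReal s * ENNReal.ofReal (ε / 2 / s) + ENNReal.ofReal (ε / 2) :=
        add_le_add (mul_le_mul_right hE _) hs1.le
    _ = ENNReal.ofReal ε := by
        rw [← ENNReal.ofReal_mul hs2.le, ← ENNReal.ofReal_add (by positivity) (by positivity)]
        congr 1
        field_simp
        ring

theorem exists_tendsto_ultrafilter_of_abs_le {ι : Type*} (U : Ultrafilter ι) {a : ι → ℝ} {M : ℝ}
    (h : ∀ n, |a n| ≤ M) : ∃ l, Tendsto a U (𝓝 l) := by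
  have hmem : Set.Icc (-M) M ∈ (U.map a : Filter ℝ) :=
    mem_map.2 (Eventually.of_forall fun n => abs_le.1 (h n))
  obtain ⟨l, -, hl⟩ := isCompact_Icc.ultrafilter_le_nhds' (U.map a) hmem
  exact ⟨l, hl⟩

/-- Round `ψ` down to a multiple of `ε`; boundedness leaves finitely many values. -/
theorem exists_floor_approx {ψ : α → ℝ} (hψ : Measurable ψ) {C : ℝ} (hC : ∀ x, |ψ x| ≤ C)
    {ε : ℝ} (hε : 0 < ε) :
    ∃ (T : Finset ℤ) (E : ℤ → Set α) (c : ℤ → ℝ), (∀ k, MeasurableSet (E k)) ∧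
      ∀ x, |ψ x - ∑ k ∈ T, (E k).indicator (fun _ => c k) x| ≤ ε := by
  refine ⟨Finset.Icc ⌊-C / ε⌋ ⌊C / ε⌋, fun k => {x | ⌊ψ x / ε⌋ = k}, fun k => k * ε, fun k => ?_,
    fun x => ?_⟩
  · exact (hψ.div_const ε).floor (measurableSet_singleton k)
  · have hx := abs_le.1 (hC x)
    have hT : ⌊ψ x / ε⌋ ∈ Finset.Icc ⌊-C / ε⌋ ⌊C / ε⌋ := by
      rw [Finset.mem_Icc]
      exact ⟨Int.floor_mono (by gcongr; exact hx.1), Int.floor_mono (by gcongr; exact hx.2)⟩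
    rw [Finset.sum_eq_single_of_mem _ hT]
    · simp only [Set.indicator, Set.mem_ofPred_eq, if_true]
      have h1 := Int.floor_le (ψ x / ε)
      have h2 := Int.lt_floor_add_one (ψ x / ε)
      rw [le_div_iff₀ hε] at h1
      rw [div_lt_iff₀ hε] at h2
      rw [abs_le]
      constructor <;> linarith
    · intro k _ hk
      simp [Set.indicator, hk.symm]

theorem integral_mul_sum_indicator {u : α → ℝ} (hu : Integrable u μ) (T : Finset ℤ)
    {E : ℤ → Set α} (hE : ∀ k, MeasurableSet (E k)) (c : ℤ → ℝ) :
    ∫ x, (∑ k ∈ T, (E k).indicator (fun _ => c k) x) * u x ∂μ =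
      ∑ k ∈ T, c k * ∫ x in E k, u x ∂μ := by
  simp_rw [Finset.sum_mul]
  have e : ∀ k x, (E k).indicator (fun _ => c k) x * u x =
      (E k).indicator (fun x => c k * u x) x := by
    intro k x
    by_cases h : x ∈ E k <;> simp [h]
  simp_rw [e]
  rw [integral_finsetSum]
  · refine Finset.sum_congr rfl fun k _ => ?_
    rw [integral_indicator (hE k), integral_const_mul]
  · exact fun k _ => (hu.const_mul _).indicator (hE k)

theorem abs_integral_mul_sub_integral_mul_le {u φ ψ : α → ℝ} (hu : Integrable u μ)
    (hφ : Integrable (fun x => φ x * u x) μ) (hψ : Integrable (fun x => ψ x * u x) μ) {ε M : ℝ}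
    (hε : ∀ x, |φ x - ψ x| ≤ ε) (hε0 : 0 ≤ ε) (hM : ∫ x, |u x| ∂μ ≤ M) :
    |∫ x, φ x * u x ∂μ - ∫ x, ψ x * u x ∂μ| ≤ ε * M := by
  rw [← integral_sub hφ hψ]
  calc |∫ x, (φ x * u x - ψ x * u x) ∂μ| ≤ ∫ x, ε * |u x| ∂μ := by
        rw [← Real.norm_eq_abs]
        refine norm_integral_le_of_norm_le (hu.abs.const_mul ε) (ae_of_all _ fun x => ?_)
        rw [← sub_mul, Real.norm_eq_abs, abs_mul]
        exact mul_le_mul_of_nonneg_right (hε x) (abs_nonneg _)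
    _ ≤ ε * M := by
        rw [integral_const_mul]
        exact mul_le_mul_of_nonneg_left hM hε0

/-- A uniformly integrable sequence on a finite measure space converges weakly along every
ultrafilter. -/
theorem exists_weak_limit_of_uniformly_integrable {ι : Type*} (U : Ultrafilter ι)
    [IsFiniteMeasure μ] {u : ι → α → ℝ} (hu : ∀ n, Integrable (u n) μ) {M : ℝ}
    (hM : ∀ n, ∫ x, |u n x| ∂μ ≤ M)
    (hui : ∀ ε : ℝ, 0 < ε → ∃ δ : ENNReal, 0 < δ ∧ ∀ n E, μ E ≤ δ →
      ∫⁻ x in E, ‖u n x‖ₑ ∂μ ≤ ENNReal.ofReal ε) :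
    ∃ g : α → ℝ, Measurable g ∧ Integrable g μ ∧ ∀ ψ : α → ℝ, Measurable ψ →
      (∃ C, ∀ x, |ψ x| ≤ C) →
      Tendsto (fun n => ∫ x, ψ x * u n x ∂μ) U (𝓝 (∫ x, ψ x * g x ∂μ)) := by
  classical
  have hbd : ∀ n E, |∫ x in E, u n x ∂μ| ≤ M := fun n E =>
    (abs_integral_le_integral_abs).trans ((setIntegral_le_integral (hu n).abs
      (ae_of_all _ fun x => abs_nonneg _)).trans (hM n))
  -- The ultrafilter gives limits for all sets at once, so no diagonal subsequence is needed.
  choose ℓ hℓ using fun E => exists_tendsto_ultrafilter_of_abs_le U (fun n => hbd n E)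
  have hsmall : ∀ ε : ℝ, 0 < ε → ∃ δ : ENNReal, 0 < δ ∧ ∀ n E, μ E ≤ δ →
      |∫ x in E, u n x ∂μ| ≤ ε := by
    intro ε hε
    obtain ⟨δ, hδ, h⟩ := hui ε hε
    refine ⟨δ, hδ, fun n E hE => ?_⟩
    rw [← ENNReal.ofReal_le_ofReal_iff hε.le]
    refine le_trans ?_ (h n E hE)
    rw [← Real.norm_eq_abs, ofReal_norm]
    exact enorm_integral_le_lintegral_enorm _
  -- Finite additivity passes to the limit, and uniform integrability controls the tail of a
  -- countable union.
  let ν : SignedMeasure α :=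
    { measureOf' := fun E => if MeasurableSet E then ℓ E else 0
      empty' := by
        have h1 := hℓ ∅
        simp only [Measure.restrict_empty, integral_zero_measure] at h1
        simpa using tendsto_nhds_unique h1 tendsto_const_nhds
      not_measurable' := fun E hE => if_neg hE
      m_iUnion' := by
        intro A hA hdis
        simp only [hA, MeasurableSet.iUnion hA, if_true]
        rw [HasSum, SummationFilter.unconditional_filter, Metric.tendsto_nhds]
        intro ε hε
        obtain ⟨δ, hδ, h⟩ := hsmall (ε / 2) (half_pos hε)
        have hsum : ∑' i, μ (A i) ≠ ⊤ := by
          rw [← measure_iUnion hdis hA]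
          exact measure_ne_top μ _
        have htail := ENNReal.tendsto_tsum_compl_atTop_zero hsum
        filter_upwards [htail.eventually_lt_const hδ] with s hs
        have hrest : μ ((⋃ i, A i) \ ⋃ i ∈ s, A i) ≤ δ := by
          refine le_trans ?_ hs.le
          refine (measure_mono ?_).trans (measure_iUnion_le (fun i : {x // x ∉ s} => A i))
          intro x hx
          simp only [Set.mem_sdiff, Set.mem_iUnion, not_exists] at hx ⊢
          obtain ⟨⟨i, hi⟩, hx2⟩ := hx
          exact ⟨⟨i, fun his => hx2 i his hi⟩, hi⟩
        have hlim : Tendsto (fun n => |∑ i ∈ s, ∫ x in A i, u n x ∂μ - ∫ x in ⋃ i, A i, u n x ∂μ|)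
            U (𝓝 |∑ i ∈ s, ℓ (A i) - ℓ (⋃ i, A i)|) :=
          ((tendsto_finsetSum s fun i _ => hℓ (A i)).sub (hℓ _)).abs
        have hle : |∑ i ∈ s, ℓ (A i) - ℓ (⋃ i, A i)| ≤ ε / 2 := by
          refine le_of_tendsto hlim (Eventually.of_forall fun n => ?_)
          have hms : MeasurableSet (⋃ i ∈ s, A i) := s.measurableSet_biUnion fun i _ => hA i
          have e1 : ∫ x in ⋃ i ∈ s, A i, u n x ∂μ = ∑ i ∈ s, ∫ x in A i, u n x ∂μ :=
            integral_biUnion_finset s (fun i _ => hA i) (fun i _ j _ hij => hdis hij)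
              fun i _ => (hu n).integrableOn
          have e2 := setIntegral_sdiff (f := u n) (μ := μ) hms (hu n).integrableOn
            (Set.iUnion₂_subset fun i _ => Set.subset_iUnion A i)
          rw [← e1, abs_sub_comm, ← e2]
          exact h n _ hrest
        rw [Real.dist_eq]
        linarith }
  have hν : ∀ E, MeasurableSet E → ν E = ℓ E := fun E hE => if_pos hE
  -- On null sets every term is `0`, hence so is the limit; the Radon–Nikodym density of `ν` is the
  -- weak limit.
  have hac : ν ≪ᵥ μ.toENNRealVectorMeasure := by
    refine VectorMeasure.AbsolutelyContinuous.mk fun E hE h0 => ?_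
    rw [Measure.toENNRealVectorMeasure_apply_measurable hE] at h0
    rw [hν E hE]
    refine tendsto_nhds_unique (hℓ E) ?_
    have : ∀ n, ∫ x in E, u n x ∂μ = 0 := fun n => setIntegral_measure_zero _ h0
    simp [this]
  have hrn := SignedMeasure.withDensityᵥ_rnDeriv_eq ν μ hac
  set g := ν.rnDeriv μ with hg
  have hgi : Integrable g μ := SignedMeasure.integrable_rnDeriv ν μ
  have hgE : ∀ E, MeasurableSet E → ∫ x in E, g x ∂μ = ℓ E := by
    intro E hE
    rw [← hν E hE, ← hrn, withDensityᵥ_apply hgi hE]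
  refine ⟨g, SignedMeasure.measurable_rnDeriv ν μ, hgi, fun ψ hψ ⟨C, hC⟩ => ?_⟩
  set M' := max M (∫ x, |g x| ∂μ) with hM'
  have hM'0 : 0 ≤ M' := (integral_nonneg fun x => abs_nonneg (g x)).trans (le_max_right _ _)
  rw [Metric.tendsto_nhds]
  intro ε hε
  -- Replacing `ψ` by a simple function costs at most `ε / 4` in each of the two integrals, leaving
  -- `ε / 2` for the simple function; the `+ 1` guards against `M' = 0`.
  obtain ⟨T, E, c, hE, happ⟩ := exists_floor_approx hψ hC
    (ε := ε / (4 * (M' + 1))) (by positivity)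
  set s : α → ℝ := fun x => ∑ k ∈ T, (E k).indicator (fun _ => c k) x with hs
  have hψi : ∀ {w : α → ℝ}, Integrable w μ → Integrable (fun x => ψ x * w x) μ := fun hw =>
    hw.bdd_mul hψ.aestronglyMeasurable (ae_of_all _ hC)
  have hsi : ∀ {w : α → ℝ}, Integrable w μ → Integrable (fun x => s x * w x) μ := by
    intro w hw
    have hsm : Measurable s := Finset.measurable_fun_sum _ fun k _ => measurable_const.indicator (hE k)
    refine hw.bdd_mul (c := ε / (4 * (M' + 1)) + C) hsm.aestronglyMeasurable (ae_of_all _ fun x => ?_)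
    have h1 := abs_sub_abs_le_abs_sub (s x) (ψ x)
    rw [abs_sub_comm] at h1
    rw [Real.norm_eq_abs]
    linarith [happ x, hC x]
  have hquant : ε / (4 * (M' + 1)) * M' ≤ ε / 4 := by
    rw [div_mul_eq_mul_div, div_le_div_iff₀ (by positivity) (by positivity)]
    nlinarith
  have hslim : Tendsto (fun n => ∫ x, s x * u n x ∂μ) U (𝓝 (∫ x, s x * g x ∂μ)) := by
    rw [integral_mul_sum_indicator hgi T hE c]
    simp_rw [hs, integral_mul_sum_indicator (hu _) T hE c]
    refine tendsto_finsetSum _ fun k _ => ?_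
    rw [hgE _ (hE k)]
    exact (hℓ (E k)).const_mul _
  filter_upwards [Metric.tendsto_nhds.1 hslim (ε / 2) (half_pos hε)] with n hn
  have h1 := abs_integral_mul_sub_integral_mul_le (M := M') (hu n) (hψi (hu n)) (hsi (hu n)) happ
    (by positivity) ((hM n).trans (le_max_left _ _))
  have h2 := abs_integral_mul_sub_integral_mul_le (M := M') hgi (hψi hgi) (hsi hgi) happ
    (by positivity) (le_max_right M _)
  rw [Real.dist_eq] at hn ⊢
  rw [abs_le] at h1 h2
  rw [abs_lt] at hn ⊢
  constructor <;> linarith [h1.1, h1.2, h2.1, h2.2, hn.1, hn.2]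

end WeakCompactness

/-! ### Difference quotients of means and existence of the weak gradient. -/

theorem volume_real_ball {d : ℕ} (a : Rd d) {r : ℝ} (hr : 0 < r) :
    volume.real (Metric.ball a r) = r ^ d * volume.real (Metric.ball (0 : Rd d) 1) := by
  rw [measureReal_def, Measure.addHaar_ball_of_pos _ _ hr, ENNReal.toReal_mul,
    ENNReal.toReal_ofReal (by positivity), measureReal_def, finrank_euclideanSpace,
    Fintype.card_fin]

theorem abs_setAverage_sub_setAverage_le {d : ℕ} {f : Rd d → ℝ} (hf : LocallyIntegrable f volume)
    {a b : Rd d} {r s : ℝ} (hr : 0 < r) (hs : 0 < s)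
    (hsub : Metric.ball b s ⊆ Metric.ball a r) :
    |(⨍ y in Metric.ball b s, f y) - ⨍ y in Metric.ball a r, f y| ≤
      (r / s) ^ d * meanOsc f (a, r) := by
  rw [meanOsc_eq]
  set c := ⨍ y in Metric.ball a r, f y with hc
  have hcs : ∀ (x : Rd d) (t : ℝ), IntegrableOn (fun _ : Rd d => c) (Metric.ball x t) :=
    fun x t => integrableOn_const measure_ball_lt_top.ne
  have hb := integrableOn_ball_of_locallyIntegrable hf b s
  have ha := integrableOn_ball_of_locallyIntegrable hf a r
  have hVs := volume_ball_ne_zero b hs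
  have hV1 := volume_ball_ne_zero (0 : Rd d) one_pos
  have e : (⨍ y in Metric.ball b s, f y) - c =
      (volume.real (Metric.ball b s))⁻¹ * ∫ y in Metric.ball b s, (f y - c) := by
    rw [integral_sub hb (hcs b s), setIntegral_const, setAverage_eq]
    simp only [smul_eq_mul]
    field_simp
  have h1 : |∫ y in Metric.ball b s, (f y - c)| ≤ ∫ y in Metric.ball a r, |f y - c| :=
    abs_integral_le_integral_abs.trans (setIntegral_mono_set (ha.sub (hcs a r)).abs
      (ae_of_all _ fun x => abs_nonneg _) hsub.eventuallyLE)
  rw [e, abs_mul, abs_of_nonneg (by positivity), volume_real_ball b hs, volume_real_ball a hr]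
  calc _ ≤ (s ^ d * volume.real (Metric.ball (0 : Rd d) 1))⁻¹ *
        ∫ y in Metric.ball a r, |f y - c| := mul_le_mul_of_nonneg_left h1 (by positivity)
    _ = _ := by
      rw [div_pow]
      field_simp

/-- The difference quotient of the means of `f` over balls of radius `ε`, with increment `ε e`. -/
noncomputable def meanQuotient {d : ℕ} (f : Rd d → ℝ) (e : Rd d) (ε : ℝ) (x : Rd d) : ℝ :=
  ((⨍ y in Metric.ball (x + ε • e) ε, f y) - ⨍ y in Metric.ball x ε, f y) / ε

theorem measurable_meanQuotient {d : ℕ} {f : Rd d → ℝ} (hf : Measurable f) (e : Rd d) (ε : ℝ) :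
    Measurable (meanQuotient f e ε) := by
  have h : Measurable fun q : Rd d × ℝ => ⨍ x in Metric.ball q.1 q.2, f x :=
    measurable_setAverage_ball (Ψ := fun w => f w.2) (hf.comp measurable_snd)
  have h1 : Measurable fun x : Rd d => ⨍ y in Metric.ball (x + ε • e) ε, f y :=
    h.comp (g := fun q : Rd d × ℝ => ⨍ x in Metric.ball q.1 q.2, f x)
      (f := fun x : Rd d => (x + ε • e, ε)) (by fun_prop)
  have h2 : Measurable fun x : Rd d => ⨍ y in Metric.ball x ε, f y :=
    h.comp (g := fun q : Rd d × ℝ => ⨍ x in Metric.ball q.1 q.2, f x)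
      (f := fun x : Rd d => (x, ε)) (by fun_prop)
  exact (h1.sub h2).div_const ε

/-- For `r ≥ 2ε` both `ε`-balls lie in `B_r(x)`, and `r ≤ 3ε` bounds each volume ratio by `3^d`. The
freedom in `r` gives a set of radii of positive measure. -/
theorem abs_meanQuotient_le {d : ℕ} {f : Rd d → ℝ} (hf : LocallyIntegrable f volume)
    {e : Rd d} (he : ‖e‖ ≤ 1) {ε r : ℝ} (hε : 0 < ε) (h2 : 2 * ε ≤ r) (h3 : r ≤ 3 * ε) (x : Rd d) :
    |meanQuotient f e ε x| ≤ 2 * 3 ^ d * meanOsc f (x, r) / ε := by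
  have hr : 0 < r := by linarith
  have hrs : (r / ε) ^ d ≤ 3 ^ d := by
    gcongr
    rwa [div_le_iff₀ hε]
  have hm := meanOsc_nonneg f x r
  have hs1 : Metric.ball (x + ε • e) ε ⊆ Metric.ball x r := by
    refine Metric.ball_subset_ball' ?_
    rw [dist_eq_norm, add_sub_cancel_left, norm_smul, Real.norm_of_nonneg hε.le]
    nlinarith
  have hs2 : Metric.ball x ε ⊆ Metric.ball x r := Metric.ball_subset_ball (by linarith)
  have k1 := (abs_setAverage_sub_setAverage_le hf hr hε hs1).trans
    (mul_le_mul_of_nonneg_right hrs hm)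
  have k2 := (abs_setAverage_sub_setAverage_le hf hr hε hs2).trans
    (mul_le_mul_of_nonneg_right hrs hm)
  rw [meanQuotient, abs_div, abs_of_pos hε]
  gcongr
  rw [abs_le] at k1 k2 ⊢
  constructor <;> linarith [k1.1, k1.2, k2.1, k2.2]

/-- If the quotient at `x` exceeds `t`, all of `{x} × [2ε, 3ε]` lies in the superlevel set at height
`κ = tε / (2·3^d)`. Its radii have weight at least `ε (3ε)^(-p-1)`, and the powers of `ε` cancel
against `κ^p`. -/
theorem weak_bound_meanQuotient {d : ℕ} {p : ℝ} (hp : 1 < p) {f : Rd d → ℝ} (hfm : Measurable f)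
    (hf : LocallyIntegrable f volume) {A : ENNReal}
    (hA : ∀ κ : ℝ, 0 < κ →
      ENNReal.ofReal (κ ^ p) * halfSpaceMeasure d p {q | κ < meanOsc f q} ≤ A)
    {e : Rd d} (he : ‖e‖ ≤ 1) {ε : ℝ} (hε : 0 < ε) {t : ℝ} (ht : 0 < t) :
    ENNReal.ofReal (t ^ p) * volume {x | t < |meanQuotient f e ε x|} ≤
      ENNReal.ofReal ((2 * 3 ^ d) ^ p * 3 ^ (p + 1)) * A := by
  set S : Set (Rd d) := {x | t < |meanQuotient f e ε x|} with hS
  have hSm : MeasurableSet S :=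
    measurableSet_lt measurable_const (measurable_norm.comp (measurable_meanQuotient hfm e ε))
  set κ : ℝ := t * ε / (2 * 3 ^ d) with hκ
  have hκ0 : 0 < κ := by positivity
  have hsub : S ×ˢ Set.Icc (2 * ε) (3 * ε) ⊆ {q | κ < meanOsc f q} := by
    rintro ⟨x, r⟩ ⟨hx, hr⟩
    have h1 := lt_of_lt_of_le hx (abs_meanQuotient_le hf he hε hr.1 hr.2 x)
    rw [lt_div_iff₀ hε] at h1
    change κ < meanOsc f (x, r)
    rw [hκ, div_lt_iff₀ (by positivity)]
    linarith
  have hIcc : MeasurableSet (S ×ˢ Set.Icc (2 * ε) (3 * ε)) := hSm.prod measurableSet_Icc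
  have hlow : ENNReal.ofReal (ε * (1 / (3 * ε) ^ (p + 1))) * volume S ≤
      halfSpaceMeasure d p (S ×ˢ Set.Icc (2 * ε) (3 * ε)) := by
    rw [← lintegral_indicator_one hIcc,
      lintegral_halfSpaceMeasure p (measurable_one.indicator hIcc)]
    calc _ = ∫⁻ _ in Set.Icc (2 * ε) (3 * ε),
          ENNReal.ofReal (1 / (3 * ε) ^ (p + 1)) * volume S := by
          rw [setLIntegral_const, Real.volume_Icc, ENNReal.ofReal_mul hε.le]
          rw [show 3 * ε - 2 * ε = ε by ring]
          ring
      _ ≤ ∫⁻ ρ in Set.Icc (2 * ε) (3 * ε), ∫⁻ a, ENNReal.ofReal (1 / ρ ^ (p + 1)) *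
          (S ×ˢ Set.Icc (2 * ε) (3 * ε)).indicator 1 (a, ρ) := by
          refine setLIntegral_mono' measurableSet_Icc fun ρ hρ => ?_
          have hρ0 : 0 < ρ := by linarith [hρ.1]
          rw [lintegral_const_mul' _ _ ENNReal.ofReal_ne_top]
          have e1 : ∫⁻ a, (S ×ˢ Set.Icc (2 * ε) (3 * ε)).indicator (1 : Rd d × ℝ → ENNReal) (a, ρ) =
              volume S := by
            rw [← lintegral_indicator_one hSm]
            refine lintegral_congr fun a => ?_
            have h23 : 2 * ε ≤ ρ ∧ ρ ≤ 3 * ε := hρ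
            by_cases haS : a ∈ S <;> simp [Set.indicator, haS, h23]
          rw [e1]
          gcongr
          exact hρ.2
      _ ≤ _ := lintegral_mono_set fun ρ hρ => by
          have : 2 * ε ≤ ρ := hρ.1
          exact Set.mem_Ioi.2 (by linarith)
  have h1 := (mul_le_mul_right (hlow.trans (measure_mono hsub)) (ENNReal.ofReal (κ ^ p))).trans
    (hA κ hκ0)
  have e2 : t ^ p = ((2 * 3 ^ d) ^ p * 3 ^ (p + 1)) *
      (κ ^ p * (ε * (1 / (3 * ε) ^ (p + 1)))) := by
    rw [hκ, Real.div_rpow (by positivity) (by positivity), Real.mul_rpow ht.le hε.le,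
      Real.mul_rpow (by norm_num) hε.le, Real.rpow_add hε, Real.rpow_one]
    field_simp
  rw [e2, ENNReal.ofReal_mul (by positivity), mul_assoc]
  refine mul_le_mul_right ?_ _
  rw [ENNReal.ofReal_mul (by positivity), mul_assoc]
  exact h1

/-- Subtract the quotients in the directions `e + z` and `z`; by linearity `z` drops out. -/
theorem tendsto_difference_quotient {d : ℕ} {ψ : Rd d → ℝ} (hψ : ContDiff ℝ ∞ ψ) (e z x : Rd d) :
    Tendsto (fun ε : ℝ => (ψ (x - ε • e - ε • z) - ψ (x - ε • z)) / ε) (𝓝[>] 0)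
      (𝓝 (-(fderiv ℝ ψ x e))) := by
  have key : ∀ v : Rd d, Tendsto (fun ε : ℝ => ε⁻¹ • (ψ (x - ε • v) - ψ x)) (𝓝[>] 0)
      (𝓝 (-(fderiv ℝ ψ x v))) := by
    intro v
    have h1 : HasDerivAt (fun t : ℝ => x - t • v) (-v) 0 := by
      simpa using ((hasDerivAt_id (0 : ℝ)).smul_const v).const_sub x
    have h2 : HasFDerivAt ψ (fderiv ℝ ψ x) (x - (0 : ℝ) • v) := by
      simpa using (hψ.differentiable (by simp) x).hasFDerivAt
    have h3 := (h2.comp_hasDerivAt 0 h1).tendsto_slope_zero_right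
    rw [map_neg] at h3
    simpa using h3
  have h := (key (e + z)).sub (key z)
  rw [map_add, show -((fderiv ℝ ψ x) e + (fderiv ℝ ψ x) z) - -(fderiv ℝ ψ x) z =
    -(fderiv ℝ ψ x e) by ring] at h
  refine h.congr fun ε => ?_
  rw [smul_add, ← sub_sub, ← smul_sub, smul_eq_mul]
  ring_nf

theorem integral_mul_translate {d : ℕ} (ψ f : Rd d → ℝ) (b : Rd d) :
    ∫ x, ψ x * f (x + b) = ∫ x, f x * ψ (x - b) := by
  rw [← integral_add_right_eq_self (fun x => f x * ψ (x - b)) b]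
  refine integral_congr_ae (ae_of_all _ fun x => ?_)
  simp [mul_comm]

theorem integrable_mul_ball_translates {d : ℕ} {f ψ : Rd d → ℝ} (hfm : Measurable f)
    (hf : LocallyIntegrable f volume) (hψ : Continuous ψ) {C R : ℝ} (hC : ∀ x, ‖ψ x‖ ≤ C)
    (b : Rd d) (ε : ℝ) :
    Integrable (fun q : Rd d × Rd d => ψ q.1 * f (q.1 + b + ε • q.2))
      ((volume.restrict (Metric.ball 0 R)).prod (volume.restrict (Metric.ball (0 : Rd d) 1))) := by
  have : IsFiniteMeasure (volume.restrict (Metric.ball (0 : Rd d) 1)) :=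
    ⟨by simpa using measure_ball_lt_top⟩
  have h := integrable_translates (σ := volume.restrict (Metric.ball (0 : Rd d) 1))
    (τ := fun z => b + ε • z) (by fun_prop) (c := ‖b‖ + |ε|) (by
      refine (ae_restrict_iff' Metric.isOpen_ball.measurableSet).2 (ae_of_all _ fun z hz => ?_)
      rw [mem_ball_zero_iff] at hz
      refine (norm_add_le _ _).trans ?_
      rw [norm_smul, Real.norm_eq_abs]
      nlinarith [abs_nonneg ε]) hfm hf R
  have h2 := h.bdd_mul (c := C) (f := fun q : Rd d × Rd d => ψ q.1)
    (Continuous.aestronglyMeasurable (by fun_prop)) (ae_of_all _ fun q => hC _)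
  simpa only [add_assoc] using h2

/-- Once the means are rescaled to the unit ball, Fubini and translation move the difference
quotient from `f` to `ψ`. -/
theorem integral_mul_meanQuotient {d : ℕ} {f ψ : Rd d → ℝ} (hfm : Measurable f)
    (hf : LocallyIntegrable f volume) (hψ : Continuous ψ) (hψc : HasCompactSupport ψ)
    (e : Rd d) {ε : ℝ} (hε : 0 < ε) :
    ∫ x, ψ x * meanQuotient f e ε x = ⨍ z in Metric.ball (0 : Rd d) 1,
      ∫ x, f x * ((ψ (x - ε • e - ε • z) - ψ (x - ε • z)) / ε) := by
  obtain ⟨C, hC⟩ := hψc.exists_bound_of_continuous hψ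
  obtain ⟨R, hR, hRs⟩ := exists_ball_of_hasCompactSupport hψc
  have hψ0 : ∀ x, R ≤ ‖x‖ → ψ x = 0 := fun x hx => image_eq_zero_of_notMem_tsupport (hRs x hx)
  have i1 := integrable_mul_ball_translates (R := R) hfm hf hψ hC (ε • e) ε
  have i0 := integrable_mul_ball_translates (R := R) hfm hf hψ hC 0 ε
  simp only [add_zero] at i0
  have iD : Integrable (fun q : Rd d × Rd d =>
      ψ q.1 * ((f (q.1 + ε • e + ε • q.2) - f (q.1 + ε • q.2)) / ε))
      ((volume.restrict (Metric.ball 0 R)).prod (volume.restrict (Metric.ball (0 : Rd d) 1))) := by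
    refine ((i1.sub i0).div_const ε).congr (ae_of_all _ fun q => ?_)
    simp only [Pi.sub_apply]
    ring
  have hmul : ∀ b : Rd d, Integrable fun x => f x * ψ (x - b) := by
    intro b
    have hc : Continuous fun x => ψ (x - b) := by fun_prop
    have h := hf.integrable_smul_left_of_hasCompactSupport hc
      (hψc.comp_homeomorph (Homeomorph.subRight b))
    simpa [mul_comm] using h
  have hmul' : ∀ b : Rd d, Integrable fun x => ψ x * f (x + b) := by
    intro b
    have := (hmul b).comp_add_right b
    simpa [mul_comm] using this
  have hz : ∀ z : Rd d, ∫ x in Metric.ball 0 R,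
      ψ x * ((f (x + ε • e + ε • z) - f (x + ε • z)) / ε) =
      ∫ x, f x * ((ψ (x - ε • e - ε • z) - ψ (x - ε • z)) / ε) := by
    intro z
    rw [← integral_eq_setIntegral_ball fun x hx => by simp [hψ0 x hx]]
    have e1 : ∀ x, ψ x * ((f (x + ε • e + ε • z) - f (x + ε • z)) / ε) =
        (ψ x * f (x + (ε • e + ε • z)) - ψ x * f (x + ε • z)) / ε := by
      intro x
      rw [add_assoc]
      ring
    have e2 : ∀ x, f x * ((ψ (x - ε • e - ε • z) - ψ (x - ε • z)) / ε) =
        (f x * ψ (x - (ε • e + ε • z)) - f x * ψ (x - ε • z)) / ε := by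
      intro x
      rw [sub_sub]
      ring
    simp_rw [e1, e2]
    rw [integral_div, integral_div, integral_sub (hmul' _) (hmul' _),
      integral_sub (hmul _) (hmul _), integral_mul_translate, integral_mul_translate]
  have hV := volume_ball_ne_zero (0 : Rd d) one_pos
  have hfi : ∀ b : Rd d, IntegrableOn (fun z => f (b + ε • z)) (Metric.ball 0 1) := by
    intro b
    have h1 := integrableOn_ball_of_locallyIntegrable hf b ε
    have h2 : Integrable ((Metric.ball b ε).indicator f) :=
      (integrable_indicator_iff Metric.isOpen_ball.measurableSet).2 h1
    have h3 := (h2.comp_add_left b).comp_smul hε.ne'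
    rw [← integrable_indicator_iff Metric.isOpen_ball.measurableSet]
    refine h3.congr (ae_of_all _ fun z => ?_)
    have : b + ε • z ∈ Metric.ball b ε ↔ z ∈ Metric.ball (0 : Rd d) 1 := by
      rw [Metric.mem_ball, dist_eq_norm, add_sub_cancel_left, norm_smul,
        Real.norm_of_nonneg hε.le, mem_ball_zero_iff]
      constructor
      · intro h; nlinarith
      · intro h; nlinarith
    by_cases hz : z ∈ Metric.ball (0 : Rd d) 1
    · rw [Set.indicator_of_mem hz]
      exact Set.indicator_of_mem (this.2 hz) f
    · rw [Set.indicator_of_notMem hz]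
      exact Set.indicator_of_notMem (mt this.1 hz) f
  have hmq : ∀ x, ψ x * meanQuotient f e ε x = (volume.real (Metric.ball (0 : Rd d) 1))⁻¹ *
      ∫ z in Metric.ball (0 : Rd d) 1,
        ψ x * ((f (x + ε • e + ε • z) - f (x + ε • z)) / ε) := by
    intro x
    rw [integral_const_mul, integral_div, integral_sub (hfi _) (hfi _), meanQuotient,
      setAverage_ball_eq_unitBall _ _ hε, setAverage_ball_eq_unitBall _ _ hε, setAverage_eq,
      setAverage_eq]
    simp only [smul_eq_mul]
    ring
  rw [integral_eq_setIntegral_ball (R := R) fun x hx => by simp [hψ0 x hx]]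
  simp_rw [hmq]
  rw [integral_const_mul, integral_integral_swap iD, setAverage_eq, smul_eq_mul]
  simp_rw [hz]

/-- With the quotient on `ψ`, its Lipschitz constant gives domination in both integrals, so local
integrability of `f` suffices. -/
theorem tendsto_integral_mul_meanQuotient {d : ℕ} {f ψ : Rd d → ℝ} (hfm : Measurable f)
    (hf : LocallyIntegrable f volume) (hψ : ContDiff ℝ ∞ ψ) (hψc : HasCompactSupport ψ)
    (e : Rd d) :
    Tendsto (fun ε => ∫ x, ψ x * meanQuotient f e ε x) (𝓝[>] 0)
      (𝓝 (-∫ x, f x * fderiv ℝ ψ x e)) := by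
  obtain ⟨R, hR, hRs⟩ := exists_ball_of_hasCompactSupport hψc
  have hψ0 : ∀ x, R ≤ ‖x‖ → ψ x = 0 := fun x hx => image_eq_zero_of_notMem_tsupport (hRs x hx)
  obtain ⟨L, hL⟩ := hψ.lipschitzWith_of_hasCompactSupport hψc (by simp)
  -- For `ε ≤ 1` and `‖z‖ < 1` both shifted copies of `ψ` vanish outside the ball of radius `S`.
  set S : ℝ := R + ‖e‖ + 1 with hS
  have hfS := integrableOn_ball_of_locallyIntegrable hf 0 S
  have hbound : ∀ ε : ℝ, 0 < ε → ε ≤ 1 → ∀ z ∈ Metric.ball (0 : Rd d) 1, ∀ x,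
      ‖f x * ((ψ (x - ε • e - ε • z) - ψ (x - ε • z)) / ε)‖ ≤
        (Metric.ball 0 S).indicator (fun x => ‖f x‖ * (L * ‖e‖)) x := by
    intro ε hε hε1 z hz x
    rw [mem_ball_zero_iff] at hz
    have n1 : ‖ε • z‖ ≤ 1 := by
      rw [norm_smul, Real.norm_of_nonneg hε.le]; nlinarith [norm_nonneg z]
    have n2 : ‖ε • e‖ ≤ ‖e‖ := by
      rw [norm_smul, Real.norm_of_nonneg hε.le]; nlinarith [norm_nonneg e]
    by_cases hx : x ∈ Metric.ball 0 S
    · rw [Set.indicator_of_mem hx, norm_mul]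
      refine mul_le_mul_of_nonneg_left ?_ (norm_nonneg _)
      rw [norm_div, Real.norm_of_nonneg hε.le, div_le_iff₀ hε]
      have := hL.dist_le_mul (x - ε • e - ε • z) (x - ε • z)
      rw [dist_eq_norm, dist_eq_norm] at this
      refine this.trans (le_of_eq ?_)
      rw [show x - ε • e - ε • z - (x - ε • z) = -(ε • e) by abel, norm_neg, norm_smul,
        Real.norm_of_nonneg hε.le]
      ring
    · rw [Set.indicator_of_notMem hx]
      rw [mem_ball_zero_iff, not_lt] at hx
      have k1 : R ≤ ‖x - ε • e - ε • z‖ := by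
        have := norm_sub_norm_le x (ε • e)
        have := norm_sub_norm_le (x - ε • e) (ε • z)
        linarith
      have k2 : R ≤ ‖x - ε • z‖ := by
        have := norm_sub_norm_le x (ε • z)
        linarith [norm_nonneg e]
      simp [hψ0 _ k1, hψ0 _ k2]
  have hbint : Integrable ((Metric.ball 0 S).indicator (fun x => ‖f x‖ * (L * ‖e‖))) :=
    (integrable_indicator_iff Metric.isOpen_ball.measurableSet).2 (hfS.norm.mul_const _)
  have hsmall : ∀ᶠ ε : ℝ in 𝓝[>] 0, 0 < ε ∧ ε ≤ 1 := by
    filter_upwards [Ioc_mem_nhdsGT (zero_lt_one (α := ℝ))] with ε hε using hε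
  have hψcont := hψ.continuous
  have hmeas : ∀ ε : ℝ, Measurable fun q : Rd d × Rd d =>
      f q.2 * ((ψ (q.2 - ε • e - ε • q.1) - ψ (q.2 - ε • q.1)) / ε) := by
    intro ε
    have h1 : Measurable fun q : Rd d × Rd d =>
        (ψ (q.2 - ε • e - ε • q.1) - ψ (q.2 - ε • q.1)) / ε :=
      Continuous.measurable (by fun_prop)
    exact (hfm.comp measurable_snd).mul h1
  have hinner : ∀ z ∈ Metric.ball (0 : Rd d) 1,
      Tendsto (fun ε => ∫ x, f x * ((ψ (x - ε • e - ε • z) - ψ (x - ε • z)) / ε)) (𝓝[>] 0)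
        (𝓝 (-∫ x, f x * fderiv ℝ ψ x e)) := by
    intro z hz
    rw [← integral_neg]
    refine tendsto_integral_filter_of_dominated_convergence _ ?_ ?_ hbint ?_
    · exact Eventually.of_forall fun ε =>
        ((hmeas ε).comp (measurable_const.prodMk measurable_id)).aestronglyMeasurable
          (f := fun x => f x * ((ψ (x - ε • e - ε • z) - ψ (x - ε • z)) / ε))
    · filter_upwards [hsmall] with ε hε
      exact ae_of_all _ fun x => hbound ε hε.1 hε.2 z hz x
    · refine ae_of_all _ fun x => ?_
      have := (tendsto_difference_quotient hψ e z x).const_mul (f x)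
      rwa [mul_neg] at this
  have houter : Tendsto (fun ε => ∫ z in Metric.ball (0 : Rd d) 1,
      ∫ x, f x * ((ψ (x - ε • e - ε • z) - ψ (x - ε • z)) / ε)) (𝓝[>] 0)
      (𝓝 (∫ _ in Metric.ball (0 : Rd d) 1, -∫ x, f x * fderiv ℝ ψ x e)) := by
    refine tendsto_integral_filter_of_dominated_convergence
      (fun _ => ∫ x, (Metric.ball 0 S).indicator (fun x => ‖f x‖ * (L * ‖e‖)) x) ?_ ?_
      (integrableOn_const measure_ball_lt_top.ne) ?_
    · exact Eventually.of_forall fun ε =>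
        ((hmeas ε).stronglyMeasurable.integral_prod_right'
          (ν := (volume : Measure (Rd d)))).aestronglyMeasurable
    · filter_upwards [hsmall] with ε hε
      refine (ae_restrict_iff' Metric.isOpen_ball.measurableSet).2 (ae_of_all _ fun z hz => ?_)
      exact norm_integral_le_of_norm_le hbint
        (ae_of_all _ fun x => hbound ε hε.1 hε.2 z hz x)
    · exact (ae_restrict_iff' Metric.isOpen_ball.measurableSet).2 (ae_of_all _ hinner)
  have hV := volume_ball_ne_zero (0 : Rd d) one_pos
  have hfinal := houter.const_mul (volume.real (Metric.ball (0 : Rd d) 1))⁻¹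
  rw [setIntegral_const, smul_eq_mul, ← mul_assoc, inv_mul_cancel₀ hV, one_mul] at hfinal
  refine hfinal.congr' ?_
  filter_upwards [hsmall] with ε hε
  rw [integral_mul_meanQuotient hfm hf hψcont hψc e hε.1, setAverage_eq, smul_eq_mul]

/-- The finite measure `exp (-|x|²) dx` on `ℝ^d`. -/
noncomputable def gaussianWeight (d : ℕ) : Measure (Rd d) :=
  volume.withDensity fun x => ENNReal.ofReal (Real.exp (-‖x‖ ^ 2))

theorem gaussianWeight_le (d : ℕ) : gaussianWeight d ≤ volume := by
  have h : gaussianWeight d ≤ (volume : Measure (Rd d)).withDensity 1 := by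
    refine withDensity_mono (ae_of_all _ fun x => ?_)
    simp only [Pi.one_apply, ENNReal.ofReal_le_one, Real.exp_le_one_iff]
    nlinarith [sq_nonneg ‖x‖]
  rwa [withDensity_one] at h

instance isFiniteMeasure_gaussianWeight (d : ℕ) : IsFiniteMeasure (gaussianWeight d) := by
  refine isFiniteMeasure_withDensity_ofReal (Integrable.hasFiniteIntegral ?_)
  have h := GaussianFourier.integral_rexp_neg_mul_sq_norm (V := Rd d) (b := 1) one_pos
  by_contra hc
  simp only [neg_mul, one_mul] at h
  rw [integral_undef hc] at h
  have : 0 < (Real.pi / 1) ^ ((Module.finrank ℝ (Rd d) : ℝ) / 2) := by positivity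
  linarith

theorem integral_gaussianWeight {d : ℕ} (F : Rd d → ℝ) :
    ∫ x, F x ∂gaussianWeight d = ∫ x, Real.exp (-‖x‖ ^ 2) * F x := by
  rw [gaussianWeight, integral_withDensity_eq_integral_toReal_smul (by fun_prop)
    (ae_of_all _ fun x => ENNReal.ofReal_lt_top)]
  refine integral_congr_ae (ae_of_all _ fun x => ?_)
  simp only [smul_eq_mul]
  rw [ENNReal.toReal_ofReal (Real.exp_pos _).le]

theorem locallyIntegrable_of_integrable_gaussianWeight {d : ℕ} {G : Rd d → ℝ}
    (hG : Integrable G (gaussianWeight d)) : LocallyIntegrable G volume := by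
  have h1 : Integrable (fun x => Real.exp (-‖x‖ ^ 2) * G x) := by
    have := (integrable_withDensity_iff_integrable_smul' (by fun_prop)
      (ae_of_all _ fun x => ENNReal.ofReal_lt_top)).1 hG
    refine this.congr (ae_of_all _ fun x => ?_)
    simp only [smul_eq_mul]
    rw [ENNReal.toReal_ofReal (Real.exp_pos _).le]
  refine (locallyIntegrable_iff (μ := volume)).2 fun K hK => ?_
  have hc : Continuous fun x : Rd d => Real.exp (‖x‖ ^ 2) := by fun_prop
  have h2 := h1.integrableOn (s := K) |>.continuousOn_mul hc.continuousOn hK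
  refine h2.congr_fun_ae (ae_of_all _ fun x => ?_)
  simp only
  rw [← mul_assoc, ← Real.exp_add, add_neg_cancel, Real.exp_zero, one_mul]

/-- The quotients are bounded in weak `L^p`, hence uniformly integrable for the finite Gaussian
weight. Their weak limit agrees with their distributional limit, the derivative of `f`. -/
theorem exists_weak_partial_derivative {d : ℕ} {p : ℝ} (hp : 1 < p) {f : Rd d → ℝ}
    (hfm : Measurable f) (hf : LocallyIntegrable f volume) {A : ENNReal} (hAt : A ≠ ⊤)
    (hA : ∀ κ : ℝ, 0 < κ →
      ENNReal.ofReal (κ ^ p) * halfSpaceMeasure d p {q | κ < meanOsc f q} ≤ A)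
    {e : Rd d} (he : ‖e‖ ≤ 1) :
    ∃ G : Rd d → ℝ, Measurable G ∧ LocallyIntegrable G volume ∧
      ∀ φ : Rd d → ℝ, ContDiff ℝ ∞ φ → HasCompactSupport φ →
        ∫ x, f x * fderiv ℝ φ x e = -∫ x, G x * φ x := by
  let ε : ℕ → ℝ := fun n => 1 / ((n : ℝ) + 1)
  have hε : ∀ n, 0 < ε n := fun n => by positivity
  have hεlim : Tendsto ε atTop (𝓝[>] 0) :=
    tendsto_nhdsWithin_iff.2 ⟨tendsto_one_div_add_atTop_nhds_zero_nat, Eventually.of_forall hε⟩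
  let u : ℕ → Rd d → ℝ := fun n => meanQuotient f e (ε n)
  have hum : ∀ n, Measurable (u n) := fun n => measurable_meanQuotient hfm e (ε n)
  set B := ENNReal.ofReal ((2 * 3 ^ d) ^ p * 3 ^ (p + 1)) * A with hB
  have hBt : B ≠ ⊤ := ENNReal.mul_ne_top ENNReal.ofReal_ne_top hAt
  have hweak : ∀ n, ∀ t : ℝ, 0 < t →
      ENNReal.ofReal (t ^ p) * gaussianWeight d {x | t < |u n x|} ≤ B := fun n t ht =>
    (mul_le_mul_right (gaussianWeight_le d _) _).trans
      (weak_bound_meanQuotient hp hfm hf hA he (hε n) ht)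
  set M : ENNReal := ENNReal.ofReal 1 * gaussianWeight d Set.univ +
    B * ENNReal.ofReal ((1 : ℝ)⁻¹ ^ (p - 1) / (p - 1)) with hM
  have hMt : M ≠ ⊤ := by finiteness
  have huM : ∀ n, ∫⁻ x, ‖u n x‖ₑ ∂gaussianWeight d ≤ M := by
    intro n
    have := setLIntegral_enorm_le_of_weak_bound hp (hum n) (hweak n) Set.univ one_pos
    rwa [Measure.restrict_univ] at this
  have hui : ∀ n, Integrable (u n) (gaussianWeight d) := fun n =>
    ⟨(hum n).aestronglyMeasurable, (huM n).trans_lt hMt.lt_top⟩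
  have huM' : ∀ n, ∫ x, |u n x| ∂gaussianWeight d ≤ M.toReal := by
    intro n
    have := integral_norm_eq_lintegral_enorm (hum n).aestronglyMeasurable (μ := gaussianWeight d)
    simp only [Real.norm_eq_abs] at this
    rw [this]
    exact ENNReal.toReal_mono hMt (huM n)
  obtain ⟨G, hGm, hGi, hG⟩ := exists_weak_limit_of_uniformly_integrable (hyperfilter ℕ) hui huM'
    fun δ hδ => exists_pos_forall_setLIntegral_le_of_weak_bound hp hum hBt hweak hδ
  refine ⟨G, hGm, locallyIntegrable_of_integrable_gaussianWeight hGi, fun φ hφ hφc => ?_⟩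
  have hφcont := hφ.continuous
  -- Multiplying `φ` by the inverse of the Gaussian density turns integrals against the weight into
  -- Lebesgue integrals against `φ`; compact support keeps the product bounded.
  have hψcont : Continuous fun x => φ x * Real.exp (‖x‖ ^ 2) := by fun_prop
  obtain ⟨C, hC⟩ := (hφc.mul_right (f' := fun x => Real.exp (‖x‖ ^ 2))).exists_bound_of_continuous
    hψcont
  have h_int : ∀ w : Rd d → ℝ, ∫ x, φ x * Real.exp (‖x‖ ^ 2) * w x ∂gaussianWeight d =
      ∫ x, φ x * w x := by
    intro w
    rw [integral_gaussianWeight]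
    refine integral_congr_ae (ae_of_all _ fun x => ?_)
    have : Real.exp (-‖x‖ ^ 2) * Real.exp (‖x‖ ^ 2) = 1 := by
      rw [← Real.exp_add, neg_add_cancel, Real.exp_zero]
    simp only
    rw [show Real.exp (-‖x‖ ^ 2) * (φ x * Real.exp (‖x‖ ^ 2) * w x) =
      (Real.exp (-‖x‖ ^ 2) * Real.exp (‖x‖ ^ 2)) * (φ x * w x) by ring, this, one_mul]
  have h1 := hG _ hψcont.measurable ⟨C, hC⟩
  simp only [h_int] at h1
  have h2 := ((tendsto_integral_mul_meanQuotient hfm hf hφ hφc e).comp hεlim).mono_left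
    Nat.hyperfilter_le_atTop
  have h3 := tendsto_nhds_unique h1 h2
  simp_rw [mul_comm (G _)]
  rw [h3, neg_neg]

theorem exists_hasWeakGradient {d : ℕ} {p : ℝ} (hp : 1 < p) {f : Rd d → ℝ}
    (hfm : Measurable f) (hf : LocallyIntegrable f volume) {A : ENNReal} (hAt : A ≠ ⊤)
    (hA : ∀ κ : ℝ, 0 < κ →
      ENNReal.ofReal (κ ^ p) * halfSpaceMeasure d p {q | κ < meanOsc f q} ≤ A) :
    ∃ g : Rd d → Rd d, Measurable g ∧ HasWeakGradient f g := by
  choose G hGm hGi hG using fun i : Fin d => exists_weak_partial_derivative hp hfm hf hAt hA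
    (e := EuclideanSpace.single i 1) (by simp)
  refine ⟨fun x => WithLp.toLp 2 fun i => G i x, ?_, ?_, fun φ hφ hφc i => hG i φ hφ hφc⟩
  · exact (MeasurableEquiv.toLp 2 (Fin d → ℝ)).measurable.comp (measurable_pi_iff.2 hGm)
  · refine (locallyIntegrable_iff (μ := volume)).2 fun K hK => ?_
    have h1 : Integrable (fun x i => G i x) (volume.restrict K) :=
      Integrable.of_eval fun i => (hGi i).integrableOn_isCompact hK
    exact ContinuousLinearMap.integrable_comp
      (EuclideanSpace.equiv (Fin d) ℝ).symm.toContinuousLinearMap h1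

/-! ### Passage to measurable representatives and conclusion. -/

theorem HasWeakGradient.congr_ae {d : ℕ} {f f' : Rd d → ℝ} {g g' : Rd d → Rd d}
    (hg : HasWeakGradient f g) (hff : f =ᵐ[volume] f') (hgg : g =ᵐ[volume] g') :
    HasWeakGradient f' g' := by
  refine ⟨hg.1.congr hgg, fun φ hφ hφc i => ?_⟩
  have e1 : ∫ x, f' x * fderiv ℝ φ x (EuclideanSpace.single i 1) =
      ∫ x, f x * fderiv ℝ φ x (EuclideanSpace.single i 1) := by
    refine integral_congr_ae ?_
    filter_upwards [hff] with x hx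
    rw [hx]
  have e2 : ∫ x, g' x i * φ x = ∫ x, g x i * φ x := by
    refine integral_congr_ae ?_
    filter_upwards [hgg] with x hx
    rw [hx]
  rw [e1, e2]
  exact hg.2 φ hφ hφc i

theorem eLpNorm_ofReal_rpow {d : ℕ} {p : ℝ} (hp : 0 < p) (g : Rd d → Rd d) :
    eLpNorm g (ENNReal.ofReal p) volume ^ p = ∫⁻ x, ‖g x‖ₑ ^ p := by
  rw [eLpNorm_eq_lintegral_rpow_enorm_toReal (by simpa using hp) ENNReal.ofReal_ne_top,
    ENNReal.toReal_ofReal hp.le, ← ENNReal.rpow_mul, one_div_mul_cancel hp.ne', ENNReal.rpow_one]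

theorem limitConst_pos (d : ℕ) {p : ℝ} (hp : 0 < p) : 0 < limitConst d p :=
  mul_pos (inv_pos.2 hp) (Real.rpow_pos_of_pos (firstAbsMoment_pos d) p)

/-- Two-sided comparison of the weak quasinorm of the mean oscillation with the norm of the
gradient. -/
theorem HasWeakGradient.iSup_superlevel_bounds {d : ℕ} (hd : 1 ≤ d) {p : ℝ} (hp : 1 < p)
    {f : Rd d → ℝ} (hf : LocallyIntegrable f volume) {g : Rd d → Rd d}
    (hg : HasWeakGradient f g) :
    ENNReal.ofReal (limitConst d p) * eLpNorm g (ENNReal.ofReal p) volume ^ p ≤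
      (⨆ (κ : ℝ) (_ : 0 < κ),
        ENNReal.ofReal (κ ^ p) * halfSpaceMeasure d p {q | κ < meanOsc f q}) ∧
    (⨆ (κ : ℝ) (_ : 0 < κ),
        ENNReal.ofReal (κ ^ p) * halfSpaceMeasure d p {q | κ < meanOsc f q}) ≤
      ENNReal.ofReal ((2 ^ (d + 2)) ^ p / (p - 1)) *
        eLpNorm g (ENNReal.ofReal p) volume ^ p := by
  have hp0 : 0 < p := by linarith
  -- The estimates above need Borel functions; all quantities involved depend only on almost
  -- everywhere classes.
  have hff := hf.aestronglyMeasurable.ae_eq_mk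
  have hgg := hg.1.aestronglyMeasurable.ae_eq_mk
  have hfm := hf.aestronglyMeasurable.stronglyMeasurable_mk.measurable
  have hgm := hg.1.aestronglyMeasurable.stronglyMeasurable_mk.measurable
  have hw := hg.congr_ae hff hgg
  have hf' := hf.congr hff
  rw [meanOsc_congr_ae hff, eLpNorm_congr_ae hgg, eLpNorm_ofReal_rpow hp0]
  exact ⟨hw.limitConst_mul_le_iSup hd hp0 hfm hf' hgm,
    iSup₂_le fun κ hκ => hw.scaled_superlevel_le hp hfm hf' hgm hκ⟩

theorem abs_meanOsc {d : ℕ} (f : Rd d → ℝ) (q : Rd d × ℝ) : |meanOsc f q| = meanOsc f q :=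
  abs_of_nonneg (meanOsc_nonneg f q.1 q.2)

theorem memWeakLp_meanOsc_iff {d : ℕ} (p : ℝ) {f : Rd d → ℝ} (hf : LocallyIntegrable f volume) :
    MemWeakLp p (meanOsc f) (halfSpaceMeasure d p) ↔
      (⨆ (κ : ℝ) (_ : 0 < κ),
        ENNReal.ofReal (κ ^ p) * halfSpaceMeasure d p {q | κ < meanOsc f q}) < ⊤ := by
  have hff := hf.aestronglyMeasurable.ae_eq_mk
  have hfm := hf.aestronglyMeasurable.stronglyMeasurable_mk.measurable
  unfold MemWeakLp
  simp only [abs_meanOsc]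
  refine and_iff_right ?_
  rw [meanOsc_congr_ae hff]
  exact (measurable_meanOsc hfm).aestronglyMeasurable

theorem memHomSobolev_iff_memWeakLp {d : ℕ} (hd : 1 ≤ d) {p : ℝ} (hp : 1 < p) {f : Rd d → ℝ}
    (hf : LocallyIntegrable f volume) :
    MemHomSobolev p f ↔ MemWeakLp p (meanOsc f) (halfSpaceMeasure d p) := by
  have hp0 : 0 < p := by linarith
  rw [memWeakLp_meanOsc_iff p hf]
  constructor
  · rintro ⟨-, g, hg, hgp⟩
    refine (hg.iSup_superlevel_bounds hd hp hf).2.trans_lt (ENNReal.mul_lt_top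
      ENNReal.ofReal_lt_top (ENNReal.rpow_lt_top_of_nonneg hp0.le hgp.2.ne))
  · intro h
    have hff := hf.aestronglyMeasurable.ae_eq_mk
    have hfm := hf.aestronglyMeasurable.stronglyMeasurable_mk.measurable
    have hA : ∀ κ : ℝ, 0 < κ → ENNReal.ofReal (κ ^ p) *
        halfSpaceMeasure d p {q | κ < meanOsc (hf.aestronglyMeasurable.mk f) q} ≤ _ :=
      fun κ hκ => le_iSup₂ (f := fun (κ : ℝ) (_ : 0 < κ) => ENNReal.ofReal (κ ^ p) *
        halfSpaceMeasure d p {q | κ < meanOsc (hf.aestronglyMeasurable.mk f) q}) κ hκ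
    rw [← meanOsc_congr_ae hff] at hA
    obtain ⟨g, hgm, hg⟩ := exists_hasWeakGradient hp hfm (hf.congr hff) h.ne
      (by rwa [← meanOsc_congr_ae hff])
    have hg' : HasWeakGradient f g := hg.congr_ae hff.symm (ae_eq_refl g)
    refine ⟨hf, g, hg', hgm.aestronglyMeasurable, ?_⟩
    -- The lower bound holds for any weak gradient, so an infinite `L^p` norm would make the
    -- supremum infinite, `limitConst d p` being positive.
    have h1 := (hg'.iSup_superlevel_bounds hd hp hf).1.trans_lt h
    by_contra hc
    rw [not_lt, top_le_iff] at hc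
    rw [hc, ENNReal.top_rpow_of_pos hp0, ENNReal.mul_top
      (by simpa using limitConst_pos d hp0)] at h1
    exact lt_irrefl _ h1

theorem theorem1p1 (d : ℕ) (hd : 1 ≤ d) (p : ℝ) (hp : 1 < p) :
    (∀ f : Rd d → ℝ, LocallyIntegrable f volume →
      (MemHomSobolev p f ↔ MemWeakLp p (meanOsc f) (halfSpaceMeasure d p))) ∧
    (∃ C₁ C₂ : ℝ, 0 < C₁ ∧ 0 < C₂ ∧
      ∀ f : Rd d → ℝ, LocallyIntegrable f volume →
      ∀ g : Rd d → Rd d, HasWeakGradient f g →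
        ENNReal.ofReal C₁ * eLpNorm g (ENNReal.ofReal p) volume ^ p ≤
          (⨆ (κ : ℝ) (_ : 0 < κ),
            ENNReal.ofReal (κ ^ p) * halfSpaceMeasure d p {q | κ < meanOsc f q}) ∧
        (⨆ (κ : ℝ) (_ : 0 < κ),
            ENNReal.ofReal (κ ^ p) * halfSpaceMeasure d p {q | κ < meanOsc f q}) ≤
          ENNReal.ofReal C₂ * eLpNorm g (ENNReal.ofReal p) volume ^ p) ∧
    (∀ f : Rd d → ℝ, LocallyIntegrable f volume →
      ∀ g : Rd d → Rd d, HasWeakGradient f g → MemLp g (ENNReal.ofReal p) volume →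
        Tendsto
          (fun κ : ℝ => ENNReal.ofReal (κ ^ p) * halfSpaceMeasure d p {q | κ < meanOsc f q})
          (𝓝[>] 0)
          (𝓝 (ENNReal.ofReal (limitConst d p) *
            eLpNorm g (ENNReal.ofReal p) volume ^ p))) := by
  have hp0 : 0 < p := by linarith
  refine ⟨fun f hf => memHomSobolev_iff_memWeakLp hd hp hf,
    ⟨limitConst d p, (2 ^ (d + 2)) ^ p / (p - 1), limitConst_pos d hp0,
      div_pos (by positivity) (by linarith),
      fun f hf g hg => hg.iSup_superlevel_bounds hd hp hf⟩, fun f hf g hg hgp => ?_⟩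
  have hff := hf.aestronglyMeasurable.ae_eq_mk
  have hgg := hg.1.aestronglyMeasurable.ae_eq_mk
  have hfm := hf.aestronglyMeasurable.stronglyMeasurable_mk.measurable
  have hgm := hg.1.aestronglyMeasurable.stronglyMeasurable_mk.measurable
  have hfin : eLpNorm g (ENNReal.ofReal p) volume ^ p ≠ ⊤ :=
    (ENNReal.rpow_lt_top_of_nonneg hp0.le hgp.2.ne).ne
  rw [eLpNorm_congr_ae hgg, eLpNorm_ofReal_rpow hp0] at hfin ⊢
  rw [meanOsc_congr_ae hff]
  exact (hg.congr_ae hff hgg).tendsto_scaled_superlevel hd hp hfm (hf.congr hff) hgm hfin
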